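/- Let $(X_k)_{k\ge 0}$ and $(Y_k)_{k\ge 1}$ be sequences of random variables, with values in $\mathbb R^d$ and $\mathbb R$ respectively, adapted to a filtration $(\mathcal F_k)_{k\ge 0}$, such that for all $k\ge 1$ $$Y_k=f(X_{k-1})+\varepsilon_k,$$ where $f:\mathbb R^d\to\mathbb R$ and $(\varepsilon_k)_{k\ge1}$ is an $(\mathcal F_k)$-martingale increment: $\varepsilon_k$ is $\mathcal F_k$-measurable, $E(|\varepsilon_k|\mid\mathcal F_{k-1})<\infty$ and $E(\varepsilon_k\mid\mathcal F_{k-1})=0$ almost surely. Assume that there are an $(\mathcal F_k)$-adapted sequence $(\sigma_k)_{k\ge0}$ of positive random variables and constants $\mu,\gamma>0$ such that, almost surely, $$E\big[\exp(\mu\,\varepsilon_k^2/\sigma_{k-1}^2)\mid\mathcal F_{k-1}\big]\le\gamma\qquad\text{for all }k\ge1.$$ Let $N\ge1$ be an (almost surely) finite $(\mathcal F_k)$-stopping time and let $x\in\mathbb R^d$. No stationarity or mixing is assumed. *The procedure.* Let $|\cdot|$ be the Euclidean norm, and for $h>0$ put $$L(h)=\sum_{k=1}^N\sigma_{k-1}^{-2}\mathbf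 1_{\{|X_{k-1}-x|\le h\}},$$ and, when $L(h)>0$, $$\hat f(h)=\frac1{L(h)}\sum_{k=1}^N\sigma_{k-1}^{-2}\mathbf 1_{\{|X_{k-1}-x|\le h\}}Y_k,\qquad \tilde f(h)=\frac1{L(h)}\sum_{k=1}^N\sigma_{k-1}^{-2}\mathbf 1_{\{|X_{k-1}-x|\le h\}}f(X_{k-1}).$$ Fix $h_0>0$, $q\in(0,1)$, $b>0$, $\nu>0$, $u_0>0$, and let $\mathcal H=\{h_0q^j: j\ge0,\ L(h_0q^j)>0\}$ and $\psi(h)=1+b\log(h_0/h)$. On the event $\{L(h_0)^{-1/2}\le u_0\}$ (with $0^{-1/2}=\infty$) define $$H_{u_0}=\min\{h\in\mathcal H:(\psi(h)/L(h))^{1/2}\le u_0\},$$ $$\hat H=\max\Big\{h\in\mathcal H: h\ge H_{u_0}\text{ and }|\hat f(h)-\hat f(h')|\le\nu\Big(\frac{\psi(h')}{L(h')}\Big)^{1/2}\ \text{ for all }h'\in[H_{u_0},h]\cap\mathcal H\Big\}.$$ *The random rate.* Let $(W(h):h\in\mathcal H)$ be a family of non-negative random variables such that, on the event $\{L(h_0)^{-1/2}\le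 u_0\}$, $$\sup_{h'\in[H_{u_0},h]\cap\mathcal H}|\tilde f(h')-f(x)|\le W(h)\qquad\text{for all }h\in\mathcal H.$$ Let $\delta_0,\alpha_0>0$ and $\bar W(h)=[W(h)\vee(\delta_0(h/h_0)^{\alpha_0})]\wedge u_0$. On the event $\{L(h_0)^{-1/2}\le\bar W(h_0)\}$ define $$H^*=\min\{h\in\mathcal H:(\psi(h)/L(h))^{1/2}\le\bar W(h)\},$$ and let $$\Omega'=\{L(h_0)^{-1/2}\le\bar W(h_0),\ W(H^*)\le u_0\}.$$ **Theorem.** For every $\rho\in\big(0,\ b\mu\nu^2/(64\alpha_0(1+\gamma))\big)$ there are constants $C_0,t_0>0$, depending only on $\rho,\mu,\gamma,q,b,u_0,\delta_0,\alpha_0,\nu$, such that for all $t\ge t_0$ $$P\Big[\big\{|\hat f(\hat H)-f(x)|\ge t\,\bar W(H^*)\big\}\cap\Omega'\Big]\le C_0\,\frac{(\log(t+1))^{1+\rho/2}}{t^\rho}.$$ -/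

import Mathlib

open MeasureTheory

universe u

namespace LepskiRegression

/-- `ε 1, ε 2, …` is a martingale increment for the filtration `ℱ`: `ε (k + 1)` is
`ℱ (k + 1)`-measurable, `E(|ε (k + 1)| | ℱ k) < ∞` and `E(ε (k + 1) | ℱ k) = 0` almost surely.
Only conditional integrability is asked for (`ε (k + 1)` need not be integrable), so the centering is
written as the equality of the (finite) conditional expectations of the positive and of the
negative part. The value `ε 0` plays no role. -/
structure IsMartingaleIncrement {Ω : Type*} {mΩ : MeasurableSpace Ω} (P : Measure Ω)
    (ℱ : Filtration ℕ mΩ) (ε : ℕ → Ω → ℝ) : Prop where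
  measurable : ∀ k, Measurable[ℱ (k + 1)] (ε (k + 1))
  condLExp_abs_lt_top : ∀ k, ∀ᵐ ω ∂P,
    condLExp (ℱ k) P (fun ω' => ENNReal.ofReal |ε (k + 1) ω'|) ω < ⊤
  condExp_eq_zero : ∀ k, ∀ᵐ ω ∂P,
    condLExp (ℱ k) P (fun ω' => ENNReal.ofReal (ε (k + 1) ω')) ω =
      condLExp (ℱ k) P (fun ω' => ENNReal.ofReal (-ε (k + 1) ω')) ω

/-- One realization of the observations: the design points `X 0, …, X (N - 1)`, the responses
`Y 1, …, Y N`, the normalizations `σ 0, …, σ (N - 1)` and the sample size `N` (the sequences are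
stored with all their terms). -/
structure Obs (E : Type*) where
  X : ℕ → E
  Y : ℕ → ℝ
  σ : ℕ → ℝ
  N : ℕ

/-- The observations attached to the outcome `ω`; the sample size `N` is almost surely finite, and
the value `0` is used on the null set where it is not. -/
def observe {Ω E : Type*} (X : ℕ → Ω → E) (Y σ : ℕ → Ω → ℝ) (N : Ω → WithTop ℕ) (ω : Ω) : Obs E :=
  ⟨fun k => X k ω, fun k => Y k ω, fun k => σ k ω, (N ω).untopD 0⟩

variable {E : Type*} [PseudoMetricSpace E]

/-- The weight `σ_{k-1}⁻² 1{|X_{k-1} - x| ≤ h}`, written with the index `k - 1` in place of `k`. -/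
noncomputable def weight (D : Obs E) (x : E) (h : ℝ) (k : ℕ) : ℝ :=
  1 / D.σ k ^ 2 * (Metric.closedBall x h).indicator (fun _ => (1 : ℝ)) (D.X k)

/-- The renormalized occupation time `L(h)`. -/
noncomputable def L (D : Obs E) (x : E) (h : ℝ) : ℝ :=
  ∑ k ∈ Finset.range D.N, weight D x h k

/-- The rectangular kernel estimator `f̂(h)` (meaningful if `L(h) > 0`). -/
noncomputable def fHat (D : Obs E) (x : E) (h : ℝ) : ℝ :=
  1 / L D x h * ∑ k ∈ Finset.range D.N, weight D x h k * D.Y (k + 1)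

/-- The noiseless average `f̃(h)` (meaningful if `L(h) > 0`). -/
noncomputable def fTilde (D : Obs E) (f : E → ℝ) (x : E) (h : ℝ) : ℝ :=
  1 / L D x h * ∑ k ∈ Finset.range D.N, weight D x h k * f (D.X k)

/-- The grid `{h₀ q ^ j : j ≥ 0, L(h₀ q ^ j) > 0}` of bandwidths. -/
def grid (D : Obs E) (x : E) (h₀ q : ℝ) : Set ℝ :=
  {h | (∃ j : ℕ, h = h₀ * q ^ j) ∧ 0 < L D x h}

/-- `ψ(h) = 1 + b log(h₀ / h)`. -/
noncomputable def psi (b h₀ h : ℝ) : ℝ := 1 + b * Real.log (h₀ / h)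

/-- `(ψ(h) / L(h)) ^ (1/2)`. -/
noncomputable def rate (D : Obs E) (x : E) (b h₀ h : ℝ) : ℝ :=
  Real.sqrt (psi b h₀ h / L D x h)

/-- The bandwidth `H_u`, the minimum of the set displayed here. -/
noncomputable def Hmin (D : Obs E) (x : E) (h₀ q b u : ℝ) : ℝ :=
  sInf {h | h ∈ grid D x h₀ q ∧ rate D x b h₀ h ≤ u}

/-- The set of bandwidths accepted by Lepski's rule. -/
def accepted (D : Obs E) (x : E) (h₀ q b ν u₀ : ℝ) : Set ℝ :=
  {h | h ∈ grid D x h₀ q ∧ Hmin D x h₀ q b u₀ ≤ h ∧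
    ∀ h' ∈ grid D x h₀ q, Hmin D x h₀ q b u₀ ≤ h' → h' ≤ h →
      |fHat D x h - fHat D x h'| ≤ ν * rate D x b h₀ h'}

/-- The bandwidth `Ĥ` selected by Lepski's rule, the maximum of the accepted bandwidths. -/
noncomputable def Hhat (D : Obs E) (x : E) (h₀ q b ν u₀ : ℝ) : ℝ :=
  sSup (accepted D x h₀ q b ν u₀)

/-- `W̄(h) = [W(h) ∨ δ₀ (h / h₀) ^ α₀] ∧ u₀`, for one realization `W` of the family `(W(h))`. -/
noncomputable def Wbar (W : ℝ → ℝ) (h₀ u₀ δ₀ α₀ h : ℝ) : ℝ :=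
  min (max (W h) (δ₀ * (h / h₀) ^ α₀)) u₀

/-- The oracle bandwidth `H*`, the minimum of the set displayed here. -/
noncomputable def Hstar (D : Obs E) (x : E) (W : ℝ → ℝ) (h₀ q b u₀ δ₀ α₀ : ℝ) : ℝ :=
  sInf {h | h ∈ grid D x h₀ q ∧ rate D x b h₀ h ≤ Wbar W h₀ u₀ δ₀ α₀ h}

/-- The condition `L(h₀) ^ (-1/2) ≤ u`; it includes `L(h₀) > 0`, since `0 ^ (-1/2) = ∞` here. -/
def EnoughData (D : Obs E) (x : E) (h₀ u : ℝ) : Prop :=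
  0 < L D x h₀ ∧ L D x h₀ ^ (-(1 / 2) : ℝ) ≤ u

/-- `W` bounds the bias: if `L(h₀) ^ (-1/2) ≤ u₀` (so that `H_{u₀}` is defined), then for every `h`
in the grid, `W(h) ≥ |f̃(h') - f(x)|` for all `h'` of the grid in `[H_{u₀}, h]`. -/
def BoundsBias (D : Obs E) (f : E → ℝ) (x : E) (W : ℝ → ℝ) (h₀ q b u₀ : ℝ) : Prop :=
  EnoughData D x h₀ u₀ → ∀ h ∈ grid D x h₀ q, ∀ h' ∈ grid D x h₀ q,
    Hmin D x h₀ q b u₀ ≤ h' → h' ≤ h → |fTilde D f x h' - f x| ≤ W h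

/-- The condition defining the event `Ω'`: `L(h₀) ^ (-1/2) ≤ W̄(h₀)` and `W(H*) ≤ u₀`. -/
def GoodEvent (D : Obs E) (x : E) (W : ℝ → ℝ) (h₀ q b u₀ δ₀ α₀ : ℝ) : Prop :=
  EnoughData D x h₀ (Wbar W h₀ u₀ δ₀ α₀ h₀) ∧ W (Hstar D x W h₀ q b u₀ δ₀ α₀) ≤ u₀

/-! The infima and the supremum above are a minimum and a maximum where they are used. -/

theorem weight_nonneg (D : Obs E) (x : E) (h : ℝ) (k : ℕ) : 0 ≤ weight D x h k :=
  mul_nonneg (by positivity) (Set.indicator_nonneg (fun _ _ => zero_le_one) _)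

theorem L_mono (D : Obs E) (x : E) : Monotone (L D x) := fun _ _ hh =>
  Finset.sum_le_sum fun _ _ => mul_le_mul_of_nonneg_left
    (Set.indicator_le_indicator_of_subset (Metric.closedBall_subset_closedBall hh)
      (fun _ => zero_le_one) _) (by positivity)

theorem finite_rate_le (D : Obs E) (x : E) {h₀ q b : ℝ} (u : ℝ) (hh₀ : 0 < h₀) (hq₀ : 0 < q)
    (hq₁ : q < 1) (hb : 0 < b) : {h | h ∈ grid D x h₀ q ∧ rate D x b h₀ h ≤ u}.Finite := by
  have hlog : 0 < Real.log (1 / q) := Real.log_pos (by rw [lt_div_iff₀ hq₀]; linarith)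
  obtain ⟨n, hn⟩ := exists_nat_gt (u ^ 2 * L D x h₀ / (b * Real.log (1 / q)))
  refine ((Set.finite_lt_nat n).image fun j : ℕ => h₀ * q ^ j).subset ?_
  rintro h ⟨⟨⟨j, rfl⟩, hL⟩, hu⟩
  refine ⟨j, ?_, rfl⟩
  have hj : psi b h₀ (h₀ * q ^ j) = 1 + j * (b * Real.log (1 / q)) := by
    have : h₀ / (h₀ * q ^ j) = (1 / q) ^ j := by
      rw [one_div, inv_pow, div_mul_cancel_left₀ hh₀.ne']
    rw [psi, this, Real.log_pow]; ring
  have hpos : (0 : ℝ) ≤ j * (b * Real.log (1 / q)) := by positivity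
  have h1 : psi b h₀ (h₀ * q ^ j) / L D x (h₀ * q ^ j) ≤ u ^ 2 :=
    Real.sqrt_le_left ((Real.sqrt_nonneg _).trans hu) |>.mp hu
  have h2 : L D x (h₀ * q ^ j) ≤ L D x h₀ :=
    L_mono D x (mul_le_of_le_one_right hh₀.le (pow_le_one₀ hq₀.le hq₁.le))
  rw [div_le_iff₀ hL, hj] at h1
  have h3 := mul_le_mul_of_nonneg_left h2 (sq_nonneg u)
  rw [div_lt_iff₀ (by positivity)] at hn
  have h4 : (j : ℝ) * (b * Real.log (1 / q)) < n * (b * Real.log (1 / q)) := by linarith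
  exact_mod_cast lt_of_mul_lt_mul_right h4 (by positivity)

theorem rate_top (D : Obs E) (x : E) (b : ℝ) {h₀ : ℝ} (hh₀ : 0 < h₀) (hL : 0 < L D x h₀) :
    rate D x b h₀ h₀ = L D x h₀ ^ (-(1 / 2) : ℝ) := by
  rw [rate, psi, div_self hh₀.ne', Real.log_one, mul_zero, add_zero, one_div, Real.sqrt_inv,
    Real.rpow_neg hL.le, Real.sqrt_eq_rpow]

theorem top_mem_grid (D : Obs E) (x : E) {h₀ : ℝ} (q : ℝ) (hL : 0 < L D x h₀) :
    h₀ ∈ grid D x h₀ q := ⟨⟨0, by simp⟩, hL⟩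

theorem isLeast_Hmin (D : Obs E) (x : E) {h₀ q b u : ℝ} (hh₀ : 0 < h₀) (hq₀ : 0 < q)
    (hq₁ : q < 1) (hb : 0 < b) (hD : EnoughData D x h₀ u) :
    IsLeast {h | h ∈ grid D x h₀ q ∧ rate D x b h₀ h ≤ u} (Hmin D x h₀ q b u) := by
  have hfin := finite_rate_le D x u hh₀ hq₀ hq₁ hb
  have hne : {h | h ∈ grid D x h₀ q ∧ rate D x b h₀ h ≤ u}.Nonempty :=
    ⟨h₀, top_mem_grid D x q hD.1, (rate_top D x b hh₀ hD.1).trans_le hD.2⟩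
  exact ⟨hne.csInf_mem hfin, fun h hh => csInf_le hfin.bddBelow hh⟩

theorem isGreatest_Hhat (D : Obs E) (x : E) {h₀ q b ν u₀ : ℝ} (hh₀ : 0 < h₀) (hq₀ : 0 < q)
    (hq₁ : q < 1) (hb : 0 < b) (hν : 0 < ν) (hD : EnoughData D x h₀ u₀) :
    IsGreatest (accepted D x h₀ q b ν u₀) (Hhat D x h₀ q b ν u₀) := by
  have hmin := isLeast_Hmin D x hh₀ hq₀ hq₁ hb hD
  have hbdd : BddAbove (accepted D x h₀ q b ν u₀) := by
    refine ⟨h₀, ?_⟩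
    rintro h ⟨⟨⟨j, rfl⟩, -⟩, -, -⟩
    exact mul_le_of_le_one_right hh₀.le (pow_le_one₀ hq₀.le hq₁.le)
  have hmem : Hmin D x h₀ q b u₀ ∈ accepted D x h₀ q b ν u₀ := by
    refine ⟨hmin.1.1, le_rfl, fun h' _ h1 h2 => ?_⟩
    rw [le_antisymm h2 h1, sub_self, abs_zero]
    exact mul_nonneg hν.le (Real.sqrt_nonneg _)
  have hfin : (accepted D x h₀ q b ν u₀).Finite := by
    have hpos : 0 < Hmin D x h₀ q b u₀ := by
      obtain ⟨⟨⟨j, hj⟩, -⟩, -⟩ := hmin.1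
      rw [hj]; positivity
    obtain ⟨n, hn⟩ := exists_pow_lt_of_lt_one (div_pos hpos hh₀) hq₁
    refine ((Set.finite_lt_nat n).image fun j : ℕ => h₀ * q ^ j).subset ?_
    rintro h ⟨⟨⟨j, rfl⟩, -⟩, hle, -⟩
    refine ⟨j, ?_, rfl⟩
    by_contra hcon
    have h1 : q ^ j ≤ q ^ n := pow_le_pow_of_le_one hq₀.le hq₁.le (not_lt.mp hcon)
    rw [lt_div_iff₀ hh₀] at hn
    nlinarith
  exact ⟨Set.Nonempty.csSup_mem ⟨_, hmem⟩ hfin, fun h hh => le_csSup hbdd hh⟩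

theorem isLeast_Hstar (D : Obs E) (x : E) (W : ℝ → ℝ) {h₀ q b u₀ δ₀ α₀ : ℝ} (hh₀ : 0 < h₀)
    (hq₀ : 0 < q) (hq₁ : q < 1) (hb : 0 < b)
    (hD : EnoughData D x h₀ (Wbar W h₀ u₀ δ₀ α₀ h₀)) :
    IsLeast {h | h ∈ grid D x h₀ q ∧ rate D x b h₀ h ≤ Wbar W h₀ u₀ δ₀ α₀ h}
      (Hstar D x W h₀ q b u₀ δ₀ α₀) := by
  have hfin : {h | h ∈ grid D x h₀ q ∧ rate D x b h₀ h ≤ Wbar W h₀ u₀ δ₀ α₀ h}.Finite :=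
    (finite_rate_le D x u₀ hh₀ hq₀ hq₁ hb).subset
      fun h hh => ⟨hh.1, hh.2.trans (min_le_right _ _)⟩
  have hne : {h | h ∈ grid D x h₀ q ∧ rate D x b h₀ h ≤ Wbar W h₀ u₀ δ₀ α₀ h}.Nonempty :=
    ⟨h₀, top_mem_grid D x q hD.1, (rate_top D x b hh₀ hD.1).trans_le hD.2⟩
  exact ⟨hne.csInf_mem hfin, fun h hh => csInf_le hfin.bddBelow hh⟩

end LepskiRegression

namespace LepskiRegression

open scoped ENNReal

/-! Put `K = (1 + γ) / μ`. At a fixed bandwidth let `M` be the weighted sum of the noise up to time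
`N`, so that `f̂ - f̃ = M / L`. Each normalized increment is conditionally subgaussian, and `L` is
exactly the variance proxy of `M`; hence `exp (l * M - K * l ^ 2 * L)` has integral at most one for
every fixed `l` (`SubgaussianNoise.lintegral_exp_le`).

A deviation bound relative to the random `L` follows by peeling (`measure_upper_deviation_le`). The
condition `rate ≤ u₀` bounds `L` from below by `ψ / u₀ ^ 2`. Once `L` exceeds `ψ / w ^ 2`, with `w`
the deterministic floor of the bias bound, one exponential inequality suffices. In between there are
geometric shells, whose number is affine in `j` for the bandwidth `h₀ q ^ j`. Since `ψ` is affine in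
`j` as well, the probabilities are summable over the grid, and a union bound takes care of the
random bandwidths.

The selection rule enters only through the deterministic `exists_largeNoise`. If `Ĥ ≥ H*`, or if
`rate Ĥ ≤ T * W̄(H*)`, a large error forces noise of relative size `y`, an event whose probability
is exponentially small in `y ^ 2`. Otherwise the bandwidth just above `Ĥ` was rejected although the
bias is negligible against the rate, so some noise exceeds its rate by the fixed factor `3ν/8`; but
`T * W̄(H*) < u₀` then forces `T * q ^ (j α₀) ≤ u₀ / δ₀`, and `ψ` makes this event polynomially rare
in `T`. With `T = t ^ (2/3)` and `y = t ^ (1/3) / 2` both contributions are `O(t ^ (-ρ))`, which is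
stronger than the stated bound with its logarithm. -/

/-! ### Conditional subgaussian bound for one increment -/

theorem exp_le_add_exp_sq (x : ℝ) : Real.exp x ≤ x + Real.exp (x ^ 2) := by
  rcases le_or_gt |x| 1 with h | h
  · have h1 := (abs_le.mp (Real.abs_exp_sub_one_sub_id_le h)).2
    have h2 := Real.add_one_le_exp (x ^ 2)
    linarith
  · rcases lt_abs.mp h with h | h
    · have : Real.exp x ≤ Real.exp (x ^ 2) := Real.exp_le_exp.mpr (by nlinarith)
      linarith
    · have h1 : Real.exp x ≤ 1 := Real.exp_le_one_iff.mpr (by linarith)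
      have h2 := Real.add_one_le_exp (x ^ 2)
      nlinarith

/-- The exponential is bounded by a linear term plus a combination of `1` and `exp (μ z²)`, with
coefficients compatible with a subgaussian bound. -/
theorem exists_exp_mul_le (μ γ : ℝ) (hμ : 0 < μ) (hγ : 0 < γ) :
    ∃ A B : ℝ → ℝ, Measurable A ∧ Measurable B ∧ (∀ a, 0 ≤ A a) ∧ (∀ a, 0 ≤ B a) ∧
      (∀ a, A a + B a * γ ≤ Real.exp ((1 + γ) / μ * a ^ 2)) ∧
      ∀ a z, Real.exp (a * z) ≤ a * z + A a + B a * Real.exp (μ * z ^ 2) := by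
  have hms : MeasurableSet {a : ℝ | a ^ 2 / μ ≤ 1} :=
    measurableSet_le (by fun_prop) measurable_const
  -- The two regimes of `s = a ^ 2 / μ`: convexity of `exp` on `[0, μ z ^ 2]` when `s ≤ 1`, the
  -- arithmetic-geometric mean inequality when `s > 1`.
  refine ⟨fun a => if a ^ 2 / μ ≤ 1 then 1 - a ^ 2 / μ else Real.exp (a ^ 2 / μ / 2),
    fun a => if a ^ 2 / μ ≤ 1 then a ^ 2 / μ else Real.exp (a ^ 2 / μ / 2),
    Measurable.ite hms (by fun_prop) (by fun_prop), Measurable.ite hms (by fun_prop) (by fun_prop),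
    ?_, ?_, ?_, ?_⟩
  · intro a
    dsimp only
    split_ifs with h
    · linarith
    · positivity
  · intro a
    dsimp only
    split_ifs with h <;> positivity
  · intro a
    have hs : (1 + γ) / μ * a ^ 2 = (1 + γ) * (a ^ 2 / μ) := by ring
    have hs0 : 0 ≤ a ^ 2 / μ := by positivity
    rw [hs]
    dsimp only
    generalize a ^ 2 / μ = s at *
    split_ifs with h
    · have := Real.add_one_le_exp ((1 + γ) * s)
      nlinarith
    · have h1 : 1 + γ ≤ Real.exp γ := by linarith [Real.add_one_le_exp γ]
      have h2 : Real.exp (s / 2) * Real.exp γ ≤ Real.exp ((1 + γ) * s) := by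
        rw [← Real.exp_add]
        exact Real.exp_le_exp.mpr (by nlinarith)
      nlinarith [Real.exp_pos (s / 2)]
  · intro a z
    have hs0 : 0 ≤ a ^ 2 / μ := by positivity
    have hsz : (a * z) ^ 2 = a ^ 2 / μ * (μ * z ^ 2) := by field_simp
    dsimp only
    generalize a ^ 2 / μ = s at *
    split_ifs with h
    · have h1 := exp_le_add_exp_sq (a * z)
      have h2 := convexOn_exp.2 (Set.mem_univ 0) (Set.mem_univ (μ * z ^ 2))
        (sub_nonneg.mpr h) hs0 (by ring)
      simp only [smul_eq_mul, mul_zero, zero_add, Real.exp_zero, mul_one] at h2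
      rw [hsz] at h1
      linarith
    · have habs : |a * z| ≤ s / 2 + μ * z ^ 2 / 2 := by
        apply abs_le_of_sq_le_sq _ (by positivity)
        rw [hsz]
        nlinarith [sq_nonneg (s - μ * z ^ 2)]
      have h1 : Real.exp (a * z) ≤ Real.exp (s / 2 + μ * z ^ 2 / 2) :=
        Real.exp_le_exp.mpr ((le_abs_self _).trans habs)
      have h2 : -(a * z) ≤ Real.exp (s / 2 + μ * z ^ 2 / 2) := by
        have := Real.add_one_le_exp (s / 2 + μ * z ^ 2 / 2)
        linarith [neg_abs_le (a * z)]
      have h3 : Real.exp (μ * z ^ 2) = Real.exp (μ * z ^ 2 / 2) ^ 2 := by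
        rw [← Real.exp_nat_mul]; congr 1; push_cast; ring
      rw [Real.exp_add] at h1 h2
      rw [h3]
      nlinarith [mul_nonneg (Real.exp_pos (s / 2)).le
        (sq_nonneg (Real.exp (μ * z ^ 2 / 2) - 1))]

section CondLExp

variable {Ω : Type*} {m m0 : MeasurableSpace Ω} {P : Measure[m0] Ω}

/-- The densities `X` and `condLExp m P X` define measures with the same trace on `m`, and `g` sees
only that trace. No integrability is needed. -/
theorem lintegral_mul_condLExp (hm : m ≤ m0) [SigmaFinite (P.trim hm)] {X g : Ω → ℝ≥0∞}
    (hX : Measurable[m0] X) (hg : Measurable[m] g) :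
    ∫⁻ ω, g ω * condLExp m P X ω ∂P = ∫⁻ ω, g ω * X ω ∂P := by
  have h : (P.withDensity X).trim hm = (P.withDensity (condLExp m P X)).trim hm := by
    refine @Measure.ext _ m _ _ fun s hs => ?_
    rw [trim_measurableSet_eq hm hs, trim_measurableSet_eq hm hs, withDensity_apply _ (hm s hs),
      withDensity_apply _ (hm s hs), setLIntegral_condLExp hm P X hs]
  have h1 := lintegral_trim (μ := P.withDensity X) hm hg
  have h2 := lintegral_trim (μ := P.withDensity (condLExp m P X)) hm hg
  rw [lintegral_withDensity_eq_lintegral_mul _ hX (hg.mono hm le_rfl)] at h1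
  rw [lintegral_withDensity_eq_lintegral_mul _ (measurable_condLExp' m P X)
    (hg.mono hm le_rfl)] at h2
  rw [h] at h1
  simpa [mul_comm] using h2.symm.trans h1

theorem condLExp_mul_left (hm : m ≤ m0) [SigmaFinite (P.trim hm)] {X g : Ω → ℝ≥0∞}
    (hX : Measurable[m0] X) (hg : Measurable[m] g) :
    condLExp m P (fun ω => g ω * X ω) =ᵐ[P] fun ω => g ω * condLExp m P X ω := by
  refine (ae_eq_condLExp hm P _ (hg.mul (measurable_condLExp m P X)) fun s hs => ?_).symm
  rw [← lintegral_indicator (hm s hs), ← lintegral_indicator (hm s hs)]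
  refine (lintegral_congr fun ω => ?_).trans
    ((lintegral_mul_condLExp (P := P) hm hX (hg.indicator hs)).trans (lintegral_congr fun ω => ?_))
  all_goals by_cases hω : ω ∈ s <;> simp [hω]

/-- Conditioning `exp (a z) ≤ a z + A a + B a * exp (μ z ^ 2)` removes the linear term by centering.
The sign condition on `a` lets `a / σ` be an `ℝ≥0∞`-valued coefficient. -/
theorem condLExp_exp_le (hm : m ≤ m0) [IsFiniteMeasure P] {η σ a : Ω → ℝ} {μ γ : ℝ}
    (hμ : 0 < μ) (hγ : 0 < γ) (hη : Measurable[m0] η) (hσ : Measurable[m] σ)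
    (ha : Measurable[m] a) (hσ0 : ∀ᵐ ω ∂P, 0 < σ ω) (ha0 : ∀ᵐ ω ∂P, 0 ≤ a ω)
    (hfin : ∀ᵐ ω ∂P, condLExp m P (fun ω' => ENNReal.ofReal |η ω'|) ω < ⊤)
    (hcen : ∀ᵐ ω ∂P, condLExp m P (fun ω' => ENNReal.ofReal (η ω')) ω =
      condLExp m P (fun ω' => ENNReal.ofReal (-η ω')) ω)
    (hexp : ∀ᵐ ω ∂P, condLExp m P
      (fun ω' => ENNReal.ofReal (Real.exp (μ * (η ω' ^ 2 / σ ω' ^ 2)))) ω ≤ ENNReal.ofReal γ) :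
    ∀ᵐ ω ∂P, condLExp m P (fun ω' => ENNReal.ofReal (Real.exp (a ω' * (η ω' / σ ω')))) ω ≤
      ENNReal.ofReal (Real.exp ((1 + γ) / μ * a ω ^ 2)) := by
  obtain ⟨A, B, hAm, hBm, hA, hB, hAB, hexpAB⟩ := exists_exp_mul_le μ γ hμ hγ
  have hσ' := hσ.mono hm le_rfl
  have ha' := ha.mono hm le_rfl
  set c : Ω → ℝ≥0∞ := fun ω => ENNReal.ofReal (a ω / σ ω) with hc
  have hcm : Measurable[m] c := (ha.div hσ).ennreal_ofReal
  set Z : Ω → ℝ≥0∞ := fun ω => ENNReal.ofReal (Real.exp (a ω * (η ω / σ ω))) with hZ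
  have hZm : Measurable[m0] Z := by fun_prop
  set U : Ω → ℝ≥0∞ := fun ω => ENNReal.ofReal (η ω) with hU
  have hUm : Measurable[m0] U := by fun_prop
  set D : Ω → ℝ≥0∞ := fun ω => ENNReal.ofReal (-η ω) with hD
  have hDm : Measurable[m0] D := by fun_prop
  set Q : Ω → ℝ≥0∞ := fun ω => ENNReal.ofReal (Real.exp (μ * (η ω ^ 2 / σ ω ^ 2))) with hQ
  have hQm : Measurable[m0] Q := by fun_prop
  set A' : Ω → ℝ≥0∞ := fun ω => ENNReal.ofReal (A (a ω)) with hA'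
  have hA'm : Measurable[m] A' := (hAm.comp ha).ennreal_ofReal
  set B' : Ω → ℝ≥0∞ := fun ω => ENNReal.ofReal (B (a ω)) with hB'
  have hB'm : Measurable[m] B' := (hBm.comp ha).ennreal_ofReal
  have hcm' := hcm.mono hm le_rfl
  have hA'm' := hA'm.mono hm le_rfl
  have hB'm' := hB'm.mono hm le_rfl
  -- The negative part of the linear term is moved to the left, so that everything stays in `ℝ≥0∞`.
  have hpt : (Z + fun ω => c ω * D ω) ≤ᵐ[P]
      (fun ω => c ω * U ω) + (A' + fun ω => B' ω * Q ω) := by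
    filter_upwards [hσ0, ha0] with ω h1 h2
    have h3 := hexpAB (a ω) (η ω / σ ω)
    have h0 : 0 ≤ a ω / σ ω := by positivity
    have h4 : a ω * (η ω / σ ω) = a ω / σ ω * η ω := by ring
    have h5 : max (η ω) 0 - max (-η ω) 0 = η ω := by
      rcases le_total (η ω) 0 with h | h
      · rw [max_eq_right h, max_eq_left (by linarith)]; ring
      · rw [max_eq_left h, max_eq_right (by linarith)]; ring
    simp only [Pi.add_apply, hZ, hc, hD, hU, hA', hB', hQ]
    rw [← ENNReal.ofReal_mul h0, ← ENNReal.ofReal_mul h0, ← ENNReal.ofReal_mul (hB _),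
      ← ENNReal.ofReal_add (hA _) (mul_nonneg (hB _) (Real.exp_pos _).le)]
    have h6 : ENNReal.ofReal (a ω / σ ω * -η ω) = ENNReal.ofReal (a ω / σ ω * max (-η ω) 0) := by
      rw [ENNReal.ofReal_mul h0, ENNReal.ofReal_mul h0]; simp
    have h7 : ENNReal.ofReal (a ω / σ ω * η ω) = ENNReal.ofReal (a ω / σ ω * max (η ω) 0) := by
      rw [ENNReal.ofReal_mul h0, ENNReal.ofReal_mul h0]; simp
    have h8 : 0 ≤ B (a ω) * Real.exp (μ * (η ω ^ 2 / σ ω ^ 2)) :=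
      mul_nonneg (hB _) (Real.exp_pos _).le
    rw [h6, h7, ← ENNReal.ofReal_add (Real.exp_pos _).le (by positivity),
      ← ENNReal.ofReal_add (by positivity) (add_nonneg (hA _) h8)]
    apply ENNReal.ofReal_le_ofReal
    rw [← div_pow]
    have h9 : a ω / σ ω * max (η ω) 0 - a ω / σ ω * max (-η ω) 0 = a ω * (η ω / σ ω) := by
      rw [← mul_sub, h5, h4]
    linarith
  have e1 := condLExp_mono (mΩ := m) hpt
  have e2 := condLExp_add_left (mΩ := m) (P := P) (fun ω => c ω * D ω) hZm.aemeasurable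
  have e3 := condLExp_add_left (mΩ := m) (P := P) (X := fun ω => c ω * U ω)
    (A' + fun ω => B' ω * Q ω) (hcm'.mul hUm).aemeasurable
  have e4 := condLExp_add_left (mΩ := m) (P := P) (fun ω => B' ω * Q ω) hA'm'.aemeasurable
  have e5 := condLExp_mul_left (P := P) hm hDm hcm
  have e6 := condLExp_mul_left (P := P) hm hUm hcm
  have e7 := condLExp_mul_left (P := P) hm hQm hB'm
  have e8 : condLExp m P U ≤ᵐ[P] condLExp m P (fun ω' => ENNReal.ofReal |η ω'|) :=
    condLExp_mono (.of_forall fun ω => ENNReal.ofReal_le_ofReal (le_abs_self _))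
  have e9 := condLExp_eq_self hm P hA'm
  filter_upwards [e1, e2, e3, e4, e5, e6, e7, e8, hfin, hcen, hexp] with
    ω f1 f2 f3 f4 f5 f6 f7 f8 f9 f10 f11
  simp only [Pi.add_apply] at f2 f3 f4
  rw [f2, f3, f4, f5, f6, f7, ← f10, e9, add_comm] at f1
  -- Conditional integrability is what allows the equal linear terms to be cancelled.
  have hne : c ω * condLExp m P U ω ≠ ⊤ :=
    ENNReal.mul_ne_top ENNReal.ofReal_ne_top (f8.trans_lt f9).ne
  refine ((ENNReal.add_le_add_iff_left hne).mp f1).trans ?_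
  calc A' ω + B' ω * condLExp m P Q ω ≤ A' ω + B' ω * ENNReal.ofReal γ := by gcongr
    _ = ENNReal.ofReal (A (a ω) + B (a ω) * γ) := by
      rw [ENNReal.ofReal_add (hA _) (mul_nonneg (hB _) hγ.le), ENNReal.ofReal_mul (hB _)]
    _ ≤ _ := ENNReal.ofReal_le_ofReal (hAB _)

end CondLExp

/-- The conditional moment conditions on the noise `ε` normalized by `σ`. -/
structure SubgaussianNoise {Ω : Type*} {mΩ : MeasurableSpace Ω} (P : Measure Ω)
    (ℱ : Filtration ℕ mΩ) (ε σ : ℕ → Ω → ℝ) (μ γ : ℝ) : Prop where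
  increment : IsMartingaleIncrement P ℱ ε
  measurable_scale : ∀ k, Measurable[ℱ k] (σ k)
  scale_pos : ∀ᵐ ω ∂P, ∀ k, 0 < σ k ω
  exp_sq_le : ∀ k, ∀ᵐ ω ∂P, condLExp (ℱ k) P
    (fun ω' => ENNReal.ofReal (Real.exp (μ * (ε (k + 1) ω' ^ 2 / σ k ω' ^ 2)))) ω
      ≤ ENNReal.ofReal γ

/-! ### Exponential supermartingale -/

section Supermartingale

variable {Ω : Type*} {mΩ : MeasurableSpace Ω} {P : Measure Ω} {ℱ : Filtration ℕ mΩ}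
  {ε σ : ℕ → Ω → ℝ} {μ γ : ℝ}

theorem SubgaussianNoise.neg (h : SubgaussianNoise P ℱ ε σ μ γ) :
    SubgaussianNoise P ℱ (fun k ω => -ε k ω) σ μ γ where
  increment :=
    { measurable := fun k => (h.increment.measurable k).neg
      condLExp_abs_lt_top := fun k => by simpa using h.increment.condLExp_abs_lt_top k
      condExp_eq_zero := fun k => by
        filter_upwards [h.increment.condExp_eq_zero k] with ω hω
        simpa using hω.symm }
  measurable_scale := h.measurable_scale
  scale_pos := h.scale_pos
  exp_sq_le := fun k => by simpa using h.exp_sq_le k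

theorem SubgaussianNoise.lintegral_exp_sum_le [IsProbabilityMeasure P]
    (h : SubgaussianNoise P ℱ ε σ μ γ) (hμ : 0 < μ) (hγ : 0 < γ) {s : ℕ → Ω → ℝ}
    (hs : ∀ k, Measurable[ℱ k] (s k)) (hs0 : ∀ᵐ ω ∂P, ∀ k, 0 ≤ s k ω) {l : ℝ} (hl : 0 ≤ l) (n : ℕ) :
    ∫⁻ ω, ENNReal.ofReal (Real.exp (l * ∑ k ∈ Finset.range n, s k ω * (ε (k + 1) ω / σ k ω) -
      (1 + γ) / μ * l ^ 2 * ∑ k ∈ Finset.range n, s k ω ^ 2)) ∂P ≤ 1 := by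
  have hmeas : ∀ n, Measurable[ℱ n] fun ω =>
      ENNReal.ofReal (Real.exp (l * ∑ k ∈ Finset.range n, s k ω * (ε (k + 1) ω / σ k ω) -
        (1 + γ) / μ * l ^ 2 * ∑ k ∈ Finset.range n, s k ω ^ 2)) := by
    intro n
    have h1 : Measurable[ℱ n] fun ω => ∑ k ∈ Finset.range n, s k ω * (ε (k + 1) ω / σ k ω) := by
      refine Finset.measurable_fun_sum _ fun k hk => ?_
      have hk' : k < n := Finset.mem_range.mp hk
      exact ((hs k).mono (ℱ.mono hk'.le) le_rfl).mul
        (((h.increment.measurable k).mono (ℱ.mono hk') le_rfl).div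
          ((h.measurable_scale k).mono (ℱ.mono hk'.le) le_rfl))
    have h2 : Measurable[ℱ n] fun ω => ∑ k ∈ Finset.range n, s k ω ^ 2 := by
      refine Finset.measurable_fun_sum _ fun k hk => ?_
      exact ((hs k).mono (ℱ.mono (Finset.mem_range.mp hk).le) le_rfl).pow_const 2
    exact (Real.measurable_exp.comp ((h1.const_mul l).sub (h2.const_mul _))).ennreal_ofReal
  induction n with
  | zero => simp
  | succ n ih =>
    refine le_trans ?_ ih
    set G : Ω → ℝ≥0∞ := fun ω =>
      ENNReal.ofReal (Real.exp (l * ∑ k ∈ Finset.range n, s k ω * (ε (k + 1) ω / σ k ω) -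
        (1 + γ) / μ * l ^ 2 * ∑ k ∈ Finset.range n, s k ω ^ 2)) with hG
    set R : Ω → ℝ≥0∞ := fun ω =>
      ENNReal.ofReal (Real.exp (-((1 + γ) / μ * (l * s n ω) ^ 2))) with hR
    set Z : Ω → ℝ≥0∞ := fun ω =>
      ENNReal.ofReal (Real.exp (l * s n ω * (ε (n + 1) ω / σ n ω))) with hZ
    have hRm : Measurable[ℱ n] R :=
      (Real.measurable_exp.comp ((((hs n).const_mul l).pow_const 2).const_mul _).neg).ennreal_ofReal
    have hεm := (h.increment.measurable n).mono (ℱ.le (n + 1)) le_rfl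
    have hσm := (h.measurable_scale n).mono (ℱ.le n) le_rfl
    have hsm := (hs n).mono (ℱ.le n) le_rfl
    have hZm : Measurable Z := by fun_prop
    have key := condLExp_exp_le (P := P) (ℱ.le n) hμ hγ hεm (h.measurable_scale n)
      ((hs n).const_mul l) (h.scale_pos.mono fun ω hω => hω n)
      (hs0.mono fun ω hω => mul_nonneg hl (hω n)) (h.increment.condLExp_abs_lt_top n)
      (h.increment.condExp_eq_zero n) (h.exp_sq_le n)
    calc _ = ∫⁻ ω, G ω * R ω * Z ω ∂P := by
          refine lintegral_congr fun ω => ?_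
          rw [hG, hR, hZ, ← ENNReal.ofReal_mul (Real.exp_pos _).le, ← Real.exp_add,
            ← ENNReal.ofReal_mul (Real.exp_pos _).le, ← Real.exp_add, Finset.sum_range_succ,
            Finset.sum_range_succ]
          congr 2
          ring
      _ = ∫⁻ ω, G ω * R ω * condLExp (ℱ n) P Z ω ∂P :=
          (lintegral_mul_condLExp (ℱ.le n) hZm ((hmeas n).mul hRm)).symm
      _ ≤ ∫⁻ ω, G ω ∂P := by
          refine lintegral_mono_ae ?_
          filter_upwards [key] with ω hω
          calc _ ≤ G ω * R ω * ENNReal.ofReal (Real.exp ((1 + γ) / μ * (l * s n ω) ^ 2)) := by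
                gcongr
            _ = G ω := by
                rw [mul_assoc, hR, ← ENNReal.ofReal_mul (Real.exp_pos _).le, ← Real.exp_add]
                simp

/-- Fatou's lemma carries the bound to the limit. The partial sums are eventually constant, as they
will be when `s k` vanishes for `k ≥ N`. -/
theorem SubgaussianNoise.lintegral_exp_le [IsProbabilityMeasure P]
    (h : SubgaussianNoise P ℱ ε σ μ γ) (hμ : 0 < μ) (hγ : 0 < γ) {s : ℕ → Ω → ℝ}
    (hs : ∀ k, Measurable[ℱ k] (s k)) (hs0 : ∀ᵐ ω ∂P, ∀ k, 0 ≤ s k ω) {S V : Ω → ℝ}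
    (hS : ∀ᵐ ω ∂P, ∀ᶠ n in Filter.atTop,
      ∑ k ∈ Finset.range n, s k ω * (ε (k + 1) ω / σ k ω) = S ω)
    (hV : ∀ᵐ ω ∂P, ∀ᶠ n in Filter.atTop, ∑ k ∈ Finset.range n, s k ω ^ 2 = V ω)
    (l : ℝ) :
    ∫⁻ ω, ENNReal.ofReal (Real.exp (l * S ω - (1 + γ) / μ * l ^ 2 * V ω)) ∂P ≤ 1 := by
  -- The noise hypotheses are invariant under `ε ↦ -ε`, which exchanges `l` and `-l`.
  wlog hl : 0 ≤ l generalizing l ε S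
  · have := this h.neg (S := fun ω => -S ω) ?_ (-l) (by linarith)
    · simpa using this
    · filter_upwards [hS] with ω hω
      filter_upwards [hω] with n hn
      rw [← hn, ← Finset.sum_neg_distrib]
      exact Finset.sum_congr rfl fun k _ => by ring
  set F : ℕ → Ω → ℝ≥0∞ := fun n ω =>
    ENNReal.ofReal (Real.exp (l * ∑ k ∈ Finset.range n, s k ω * (ε (k + 1) ω / σ k ω) -
      (1 + γ) / μ * l ^ 2 * ∑ k ∈ Finset.range n, s k ω ^ 2)) with hF
  have hεm := fun k => (h.increment.measurable k).mono (ℱ.le (k + 1)) le_rfl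
  have hσm := fun k => (h.measurable_scale k).mono (ℱ.le k) le_rfl
  have hsm := fun k => (hs k).mono (ℱ.le k) le_rfl
  have hFm : ∀ n, Measurable (F n) := fun n => by fun_prop
  calc _ = ∫⁻ ω, Filter.liminf (fun n => F n ω) Filter.atTop ∂P := by
        refine lintegral_congr_ae ?_
        filter_upwards [hS, hV] with ω h1 h2
        have : Filter.Tendsto (fun n => F n ω) Filter.atTop
            (nhds (ENNReal.ofReal (Real.exp (l * S ω - (1 + γ) / μ * l ^ 2 * V ω)))) := by
          refine tendsto_const_nhds.congr' ?_
          filter_upwards [h1, h2] with n h3 h4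
          simp only [hF, h3, h4]
        exact this.liminf_eq.symm
    _ ≤ Filter.liminf (fun n => ∫⁻ ω, F n ω ∂P) Filter.atTop := lintegral_liminf_le hFm
    _ ≤ 1 := by
        refine Filter.liminf_le_of_le (by isBoundedDefault) fun b hb => ?_
        obtain ⟨n, hn⟩ := hb.exists
        exact hn.trans (h.lintegral_exp_sum_le hμ hγ hs hs0 hl n)

end Supermartingale

/-! ### Deviations relative to a random variance -/

section Peeling

variable {Ω : Type*} {mΩ : MeasurableSpace Ω} {P : Measure Ω} {S V : Ω → ℝ} {K : ℝ}

theorem measure_exp_ge_le (hS : AEMeasurable S P) (hV : AEMeasurable V P) {l : ℝ}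
    (h : ∫⁻ ω, ENNReal.ofReal (Real.exp (l * S ω - K * l ^ 2 * V ω)) ∂P ≤ 1) (c : ℝ) :
    P {ω | c ≤ l * S ω - K * l ^ 2 * V ω} ≤ ENNReal.ofReal (Real.exp (-c)) := by
  have h1 := mul_meas_ge_le_lintegral₀ (μ := P)
    (f := fun ω => ENNReal.ofReal (Real.exp (l * S ω - K * l ^ 2 * V ω))) (by fun_prop)
    (ENNReal.ofReal (Real.exp c))
  have h2 : {ω | c ≤ l * S ω - K * l ^ 2 * V ω} ⊆ {ω | ENNReal.ofReal (Real.exp c) ≤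
      ENNReal.ofReal (Real.exp (l * S ω - K * l ^ 2 * V ω))} := fun ω hω =>
    ENNReal.ofReal_le_ofReal (Real.exp_le_exp.mpr hω)
  have h3 : ENNReal.ofReal (Real.exp (-c)) = (ENNReal.ofReal (Real.exp c))⁻¹ := by
    rw [Real.exp_neg, ENNReal.ofReal_inv_of_pos (Real.exp_pos c)]
  rw [h3, ENNReal.le_inv_iff_mul_le, mul_comm]
  exact ((mul_le_mul_right (measure_mono h2) _).trans h1).trans h

theorem exists_peel_index {v V : ℝ} (h : v ≤ V) (n : ℕ) :
    v * 4 ^ n ≤ V ∨ ∃ i < n, v * 4 ^ i ≤ V ∧ V ≤ v * 4 ^ (i + 1) := by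
  induction n with
  | zero => left; simpa using h
  | succ n ih =>
    rcases ih with ih | ⟨i, hi, h1⟩
    · rcases le_total (v * 4 ^ (n + 1)) V with h2 | h2
      · exact Or.inl h2
      · exact Or.inr ⟨n, by omega, ih, h2⟩
    · exact Or.inr ⟨i, by omega, h1⟩

/-- The best `l` depends on the random `V`; `n + 1` deterministic values suffice, one for each shell
`[v 4^i, v 4^(i+1)]` with `i < n` and one for all `V ≥ v 4^n`. -/
theorem measure_upper_deviation_le (hK : 0 < K) (hS : AEMeasurable S P) (hV : AEMeasurable V P)
    (h : ∀ l, ∫⁻ ω, ENNReal.ofReal (Real.exp (l * S ω - K * l ^ 2 * V ω)) ∂P ≤ 1)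
    {p y u w : ℝ} (hp : 0 < p) (hy : 0 < y) (hu : 0 < u) (hw : 0 < w) {n : ℕ}
    (hn : u ≤ 2 ^ n * w) :
    P {ω | p / u ^ 2 ≤ V ω ∧ y * Real.sqrt (p * V ω) ≤ S ω ∧ y * w * V ω ≤ S ω} ≤
      ENNReal.ofReal ((n + 1) * Real.exp (-(3 / (16 * K) * y ^ 2 * p))) := by
  set v := p / u ^ 2 with hv
  have hv0 : 0 < v := by positivity
  set c := 3 / (16 * K) * y ^ 2 * p with hc
  -- On a shell, the optimal value for `V` at the upper endpoint; for `i = n`, the optimal value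
  -- when `S = y w V`, which does not depend on `V`.
  set l : ℕ → ℝ := fun i => if i < n then y * Real.sqrt p / (4 * K * Real.sqrt (v * 4 ^ i)) else
    y * w / (2 * K) with hl
  have hsub : {ω | v ≤ V ω ∧ y * Real.sqrt (p * V ω) ≤ S ω ∧ y * w * V ω ≤ S ω} ⊆
      ⋃ i ∈ Finset.range (n + 1), {ω | c ≤ l i * S ω - K * l i ^ 2 * V ω} := by
    rintro ω ⟨h1, h2, h3⟩
    simp only [Set.mem_iUnion, Set.mem_ofPred_eq, Finset.mem_range, exists_prop]
    rcases exists_peel_index h1 n with h4 | ⟨i, hi, h4, h5⟩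
    · refine ⟨n, by omega, ?_⟩
      have hpw : p ≤ w ^ 2 * V ω := by
        have : u ^ 2 ≤ (2 ^ n * w) ^ 2 := pow_le_pow_left₀ hu.le hn 2
        have h6 : p ≤ v * 4 ^ n * w ^ 2 := by
          rw [hv, div_mul_eq_mul_div, div_mul_eq_mul_div, le_div_iff₀ (by positivity)]
          have h7 : (4 : ℝ) ^ n = (2 ^ n) ^ 2 := by rw [← pow_mul, mul_comm, pow_mul]; norm_num
          rw [h7]
          nlinarith
        nlinarith [sq_nonneg w]
      have hln : l n = y * w / (2 * K) := by simp [hl]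
      have e1 : l n * (y * w * V ω) ≤ l n * S ω :=
        mul_le_mul_of_nonneg_left h3 (by rw [hln]; positivity)
      have e2 : l n * (y * w * V ω) - K * l n ^ 2 * V ω = y ^ 2 * (w ^ 2 * V ω) / (4 * K) := by
        rw [hln]; field_simp; ring
      have e3 : c ≤ y ^ 2 * (w ^ 2 * V ω) / (4 * K) := by
        rw [hc, le_div_iff₀ (by positivity)]
        have : 3 / (16 * K) * y ^ 2 * p * (4 * K) = 3 / 4 * (y ^ 2 * p) := by field_simp; ring
        rw [this]
        have := mul_le_mul_of_nonneg_left hpw (sq_nonneg y)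
        nlinarith [mul_nonneg (sq_nonneg y) hp.le]
      linarith
    · refine ⟨i, by omega, ?_⟩
      have hV0 : 0 < V ω := hv0.trans_le h1
      set a := Real.sqrt (V ω) with ha
      set b := Real.sqrt (v * 4 ^ i) with hb
      have hb0 : 0 < b := Real.sqrt_pos.mpr (by positivity)
      have hab : b ≤ a := Real.sqrt_le_sqrt h4
      have hab2 : a ≤ 2 * b := by
        have : 2 * b = Real.sqrt (v * 4 ^ (i + 1)) := by
          rw [pow_succ, ← mul_assoc, Real.sqrt_mul' _ (by norm_num : (0:ℝ) ≤ 4),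
            show (4:ℝ) = 2 ^ 2 by norm_num, Real.sqrt_sq (by norm_num)]
          rw [mul_comm]
          norm_num [hb]
        rw [this]
        exact Real.sqrt_le_sqrt h5
      have hVa : V ω = a ^ 2 := (Real.sq_sqrt hV0.le).symm
      have hpp : p = Real.sqrt p ^ 2 := (Real.sq_sqrt hp.le).symm
      have hli : l i = y * Real.sqrt p / (4 * K * b) := by simp [hl, hi, hb]
      rw [Real.sqrt_mul hp.le, ← ha] at h2
      have e1 : l i * (y * (Real.sqrt p * a)) ≤ l i * S ω :=
        mul_le_mul_of_nonneg_left h2 (by rw [hli]; positivity)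
      have e2 : l i * (y * (Real.sqrt p * a)) - K * l i ^ 2 * V ω =
          y ^ 2 * Real.sqrt p ^ 2 * (4 * a * b - a ^ 2) / (16 * K * b ^ 2) := by
        rw [hli, hVa]; field_simp; ring
      -- The constant 3 comes from `4ab - a² - 3b² = (a - b)(3b - a) ≥ 0` for `b ≤ a ≤ 2b`.
      have e3 : c ≤ y ^ 2 * Real.sqrt p ^ 2 * (4 * a * b - a ^ 2) / (16 * K * b ^ 2) := by
        rw [hc, le_div_iff₀ (by positivity), ← hpp]
        have : 3 / (16 * K) * y ^ 2 * p * (16 * K * b ^ 2) = y ^ 2 * p * (3 * b ^ 2) := by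
          field_simp
        rw [this]
        exact mul_le_mul_of_nonneg_left (by nlinarith) (by positivity)
      linarith
  calc _ ≤ P (⋃ i ∈ Finset.range (n + 1), {ω | c ≤ l i * S ω - K * l i ^ 2 * V ω}) :=
        measure_mono hsub
    _ ≤ ∑ i ∈ Finset.range (n + 1), P {ω | c ≤ l i * S ω - K * l i ^ 2 * V ω} :=
        measure_biUnion_finset_le _ _
    _ ≤ ∑ i ∈ Finset.range (n + 1), ENNReal.ofReal (Real.exp (-c)) :=
        Finset.sum_le_sum fun i _ => measure_exp_ge_le hS hV (h (l i)) c
    _ = _ := by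
        rw [Finset.sum_const, Finset.card_range, nsmul_eq_mul, ENNReal.ofReal_mul (by positivity)]
        congr 1
        rw [ENNReal.ofReal_add (by positivity) (by norm_num)]
        simp

theorem measure_deviation_le (hK : 0 < K) (hS : AEMeasurable S P) (hV : AEMeasurable V P)
    (h : ∀ l, ∫⁻ ω, ENNReal.ofReal (Real.exp (l * S ω - K * l ^ 2 * V ω)) ∂P ≤ 1)
    {p y u w : ℝ} (hp : 0 < p) (hy : 0 < y) (hu : 0 < u) (hw : 0 < w) {n : ℕ}
    (hn : u ≤ 2 ^ n * w) :
    P {ω | p / u ^ 2 ≤ V ω ∧ y * Real.sqrt (p * V ω) ≤ |S ω| ∧ y * w * V ω ≤ |S ω|} ≤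
      ENNReal.ofReal (2 * (n + 1) * Real.exp (-(3 / (16 * K) * y ^ 2 * p))) := by
  have h1 := measure_upper_deviation_le hK hS hV h hp hy hu hw hn
  have h2 := measure_upper_deviation_le (S := fun ω => -S ω) hK hS.neg hV
    (fun l => by simpa using h (-l)) hp hy hu hw hn
  have hsub : {ω | p / u ^ 2 ≤ V ω ∧ y * Real.sqrt (p * V ω) ≤ |S ω| ∧ y * w * V ω ≤ |S ω|} ⊆
      {ω | p / u ^ 2 ≤ V ω ∧ y * Real.sqrt (p * V ω) ≤ S ω ∧ y * w * V ω ≤ S ω} ∪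
      {ω | p / u ^ 2 ≤ V ω ∧ y * Real.sqrt (p * V ω) ≤ -S ω ∧ y * w * V ω ≤ -S ω} := by
    rintro ω ⟨a, b, c⟩
    rcases abs_choice (S ω) with e | e <;> rw [e] at b c
    · exact Or.inl ⟨a, b, c⟩
    · exact Or.inr ⟨a, b, c⟩
  refine (measure_mono hsub).trans ((measure_union_le _ _).trans ((add_le_add h1 h2).trans ?_))
  rw [← ENNReal.ofReal_add (by positivity) (by positivity)]
  exact ENNReal.ofReal_le_ofReal (by linarith)

end Peeling

/-! ### Deterministic analysis of the selection rule -/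

section Selection

variable {E : Type*} [PseudoMetricSpace E] {D : Obs E} {x : E}

theorem log_div_mul_pow {h₀ : ℝ} (hh₀ : 0 < h₀) (q : ℝ) (j : ℕ) :
    Real.log (h₀ / (h₀ * q ^ j)) = j * Real.log (1 / q) := by
  have : h₀ / (h₀ * q ^ j) = (1 / q) ^ j := by
    rw [one_div, inv_pow, div_mul_cancel_left₀ hh₀.ne']
  rw [this, Real.log_pow]

theorem one_le_psi {b h₀ q : ℝ} (hb : 0 < b) (hh₀ : 0 < h₀) (hq₀ : 0 < q) (hq₁ : q < 1) (j : ℕ) :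
    1 ≤ psi b h₀ (h₀ * q ^ j) := by
  have : 0 < Real.log (1 / q) := Real.log_pos (by rw [lt_div_iff₀ hq₀]; linarith)
  rw [psi, log_div_mul_pow hh₀]
  have : 0 ≤ b * (j * Real.log (1 / q)) := by positivity
  linarith

theorem rate_anti {b h₀ h h' : ℝ} (hb : 0 < b) (hh₀ : 0 < h₀) (hh : 0 < h) (hle : h ≤ h')
    (hL : 0 < L D x h) (hψ : 0 ≤ psi b h₀ h) : rate D x b h₀ h' ≤ rate D x b h₀ h := by
  refine Real.sqrt_le_sqrt (div_le_div₀ hψ ?_ hL (L_mono D x hle))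
  unfold psi
  gcongr
  exact div_pos hh₀ (hh.trans_le hle)

theorem min_le_Wbar (W : ℝ → ℝ) {h₀ q u₀ δ₀ α₀ : ℝ} (hh₀ : 0 < h₀) (j : ℕ) :
    min (δ₀ * (q ^ j) ^ α₀) u₀ ≤ Wbar W h₀ u₀ δ₀ α₀ (h₀ * q ^ j) := by
  rw [Wbar, mul_div_cancel_left₀ _ hh₀.ne']
  exact min_le_min_right _ (le_max_right _ _)

theorem EnoughData.mono {h₀ u u' : ℝ} (hD : EnoughData D x h₀ u) (h : u ≤ u') :
    EnoughData D x h₀ u' := ⟨hD.1, hD.2.trans h⟩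

/-- The stochastic part of the estimator is at least `y` times both the rate and the floor of the
bias bound, for a bandwidth `h₀ q ^ j` with rate at most `u₀`. -/
def LargeNoise (D : Obs E) (f : E → ℝ) (x : E) (h₀ q b u₀ δ₀ α₀ : ℝ) (j : ℕ) (y : ℝ) : Prop :=
  0 < L D x (h₀ * q ^ j) ∧ rate D x b h₀ (h₀ * q ^ j) ≤ u₀ ∧
    y * rate D x b h₀ (h₀ * q ^ j) ≤ |fHat D x (h₀ * q ^ j) - fTilde D f x (h₀ * q ^ j)| ∧
    y * min (δ₀ * (q ^ j) ^ α₀) u₀ ≤ |fHat D x (h₀ * q ^ j) - fTilde D f x (h₀ * q ^ j)|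

/-- A large error of the selected estimator forces a large stochastic part at some bandwidth; if
only by a constant factor, then the bandwidth is small. -/
theorem exists_largeNoise {f : E → ℝ} {W : ℝ → ℝ} {h₀ q b u₀ δ₀ α₀ ν t T y : ℝ}
    (hh₀ : 0 < h₀) (hq₀ : 0 < q) (hq₁ : q < 1) (hb : 0 < b) (hu₀ : 0 < u₀) (hδ₀ : 0 < δ₀)
    (hα₀ : 0 < α₀) (hν : 0 < ν) (hy : 0 < y) (hT : 1 ≤ T) (hTν : 8 ≤ T * ν)
    (hyt : y + ν + 1 ≤ t) (hyT : y * T + 1 ≤ t)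
    (hbias : BoundsBias D f x W h₀ q b u₀) (hgood : GoodEvent D x W h₀ q b u₀ δ₀ α₀)
    (herr : t * Wbar W h₀ u₀ δ₀ α₀ (Hstar D x W h₀ q b u₀ δ₀ α₀) ≤
      |fHat D x (Hhat D x h₀ q b ν u₀) - f x|) :
    (∃ j, LargeNoise D f x h₀ q b u₀ δ₀ α₀ j y) ∨
      ∃ j : ℕ, T * (δ₀ * (q ^ j) ^ α₀) ≤ u₀ ∧
        LargeNoise D f x h₀ q b u₀ δ₀ α₀ j (3 * ν / 8) := by
  have hD : EnoughData D x h₀ u₀ := hgood.1.mono (min_le_right _ _)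
  have hmin := isLeast_Hmin D x hh₀ hq₀ hq₁ hb hD
  have hhat := isGreatest_Hhat D x hh₀ hq₀ hq₁ hb hν hD
  have hstar := isLeast_Hstar D x W hh₀ hq₀ hq₁ hb hgood.1
  have hWle := hgood.2
  set Hs := Hstar D x W h₀ q b u₀ δ₀ α₀
  set Hh := Hhat D x h₀ q b ν u₀
  set Hm := Hmin D x h₀ q b u₀
  have hpos : ∀ j : ℕ, 0 < h₀ * q ^ j := fun j => by positivity
  have hpow_le : ∀ {i j : ℕ}, i ≤ j → h₀ * q ^ j ≤ h₀ * q ^ i := fun hij =>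
    mul_le_mul_of_nonneg_left (pow_le_pow_of_le_one hq₀.le hq₁.le hij) hh₀.le
  have hlt_of_pow_lt : ∀ {i j : ℕ}, h₀ * q ^ j < h₀ * q ^ i → i < j := fun hij => by
    by_contra hcon
    exact absurd (hpow_le (not_lt.mp hcon)) (not_le.mpr hij)
  have hrate : ∀ {h h'}, h ∈ grid D x h₀ q → h ≤ h' → rate D x b h₀ h' ≤ rate D x b h₀ h := by
    rintro h h' ⟨⟨j, rfl⟩, hL⟩ hle
    exact rate_anti hb hh₀ (hpos j) hle hL (zero_le_one.trans (one_le_psi hb hh₀ hq₀ hq₁ j))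
  have hrate_u : ∀ {h}, Hm ≤ h → rate D x b h₀ h ≤ u₀ := fun hle =>
    (hrate hmin.1.1 hle).trans hmin.1.2
  have hms : Hm ≤ Hs := hmin.2 ⟨hstar.1.1, hstar.1.2.trans (min_le_right _ _)⟩
  have hW : W Hs ≤ Wbar W h₀ u₀ δ₀ α₀ Hs := le_min (le_max_left _ _) hWle
  have hb1 : ∀ h ∈ grid D x h₀ q, Hm ≤ h → h ≤ Hs →
      |fTilde D f x h - f x| ≤ Wbar W h₀ u₀ δ₀ α₀ Hs := fun h hg h1 h2 =>
    (hbias hD Hs hstar.1.1 h hg h1 h2).trans hW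
  set ω := Wbar W h₀ u₀ δ₀ α₀ Hs with hω
  obtain ⟨js, hjs⟩ := hstar.1.1.1
  have hfloor_pos : ∀ j : ℕ, 0 < min (δ₀ * (q ^ j) ^ α₀) u₀ := fun j =>
    lt_min (by positivity) hu₀
  have hfloor : min (δ₀ * (q ^ js) ^ α₀) u₀ ≤ ω := by
    rw [hω, hjs]; exact min_le_Wbar W hh₀ js
  have hω0 : 0 < ω := (hfloor_pos js).trans_le hfloor
  -- Minimality of `H*`: strictly below it the rate exceeds the bias bound, hence its floor.
  have hsmall : ∀ j : ℕ, 0 < L D x (h₀ * q ^ j) → h₀ * q ^ j < Hs →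
      min (δ₀ * (q ^ j) ^ α₀) u₀ ≤ rate D x b h₀ (h₀ * q ^ j) := fun j hL hj => by
    refine (min_le_Wbar W hh₀ j).trans (le_of_lt ?_)
    by_contra hcon
    exact absurd (hstar.2 ⟨⟨⟨j, rfl⟩, hL⟩, not_lt.mp hcon⟩) (not_le.mpr hj)
  obtain ⟨⟨⟨jh, hjh⟩, hLh⟩, hmh, hacc⟩ := hhat.1
  -- If `Ĥ ≥ H*`, acceptance of `Ĥ` compares it with `H*`, where rate and bias are both at most
  -- `W̄(H*)`.
  rcases le_or_gt Hs Hh with hcase | hcase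
  · left
    refine ⟨js, ?_⟩
    have h1 := hacc Hs hstar.1.1 hms hcase
    have h2 := hb1 Hs hstar.1.1 hms le_rfl
    have h3 : ν * rate D x b h₀ Hs ≤ ν * ω := mul_le_mul_of_nonneg_left hstar.1.2 hν.le
    have h4 : y * ω ≤ |fHat D x Hs - fTilde D f x Hs| := by
      have e1 := abs_sub_le (fHat D x Hh) (fHat D x Hs) (f x)
      have e2 := abs_sub_le (fHat D x Hs) (fTilde D f x Hs) (f x)
      have e3 := mul_le_mul_of_nonneg_right hyt hω0.le
      linarith
    rw [LargeNoise, ← hjs]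
    exact ⟨hstar.1.1.2, hrate_u hms, (mul_le_mul_of_nonneg_left hstar.1.2 hy.le).trans h4,
      (mul_le_mul_of_nonneg_left hfloor hy.le).trans h4⟩
  have hgh : Hh ∈ grid D x h₀ q := hhat.1.1
  have hbh := hb1 Hh hgh hmh hcase.le
  rcases le_or_gt (rate D x b h₀ Hh) (T * ω) with hr | hr
  · left
    refine ⟨jh, ?_⟩
    have h4 : y * (T * ω) ≤ |fHat D x Hh - fTilde D f x Hh| := by
      have e2 := abs_sub_le (fHat D x Hh) (fTilde D f x Hh) (f x)
      have e3 := mul_le_mul_of_nonneg_right hyT hω0.le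
      linarith
    have h5 : y * rate D x b h₀ Hh ≤ |fHat D x Hh - fTilde D f x Hh| :=
      (mul_le_mul_of_nonneg_left hr hy.le).trans h4
    have h6 := hsmall jh (by rwa [← hjh]) (by rwa [← hjh])
    rw [LargeNoise]
    rw [← hjh] at h6 ⊢
    exact ⟨hLh, hrate_u hmh, h5, (mul_le_mul_of_nonneg_left h6 hy.le).trans h5⟩
  right
  have hrω : ω ≤ rate D x b h₀ Hh := by nlinarith
  have hjsh : js < jh := hlt_of_pow_lt (by rw [← hjh, ← hjs]; exact hcase)
  obtain ⟨jn, rfl⟩ : ∃ jn, jh = jn + 1 := ⟨jh - 1, by omega⟩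
  set Hn := h₀ * q ^ jn with hHn
  have hhn : Hh < Hn := by
    rw [hjh, hHn, pow_succ]
    nlinarith [hpos jn]
  have hns : Hn ≤ Hs := by rw [hjs]; exact hpow_le (by omega)
  have hgn : Hn ∈ grid D x h₀ q := ⟨⟨jn, rfl⟩, hLh.trans_le (L_mono D x hhn.le)⟩
  have hanti : ∀ j : ℕ, js ≤ j → δ₀ * (q ^ j) ^ α₀ ≤ δ₀ * (q ^ js) ^ α₀ := fun j hj =>
    mul_le_mul_of_nonneg_left (Real.rpow_le_rpow (by positivity)
      (pow_le_pow_of_le_one hq₀.le hq₁.le hj) hα₀.le) hδ₀.le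
  -- As `T ω < u₀` and `T ≥ 1`, the floor at `H*` is not truncated by `u₀`; this is what makes the
  -- bandwidth small.
  have htop : ∀ j : ℕ, js ≤ j → T * (δ₀ * (q ^ j) ^ α₀) ≤ u₀ := fun j hj => by
    refine (mul_le_mul_of_nonneg_left (hanti j hj) (by linarith)).trans ?_
    have h1 : T * min (δ₀ * (q ^ js) ^ α₀) u₀ < u₀ :=
      (mul_le_mul_of_nonneg_left hfloor (by linarith)).trans_lt (hr.trans_le (hrate_u hmh))
    rcases min_choice (δ₀ * (q ^ js) ^ α₀) u₀ with h2 | h2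
    · rw [h2] at h1; exact h1.le
    · rw [h2] at h1; nlinarith
  have hnacc : ∃ h' ∈ grid D x h₀ q, Hm ≤ h' ∧ h' ≤ Hn ∧
      ν * rate D x b h₀ h' < |fHat D x Hn - fHat D x h'| := by
    by_contra hcon
    push Not at hcon
    exact absurd (hhat.2 ⟨hgn, hmh.trans hhn.le, hcon⟩) (not_le.mpr hhn)
  obtain ⟨h', hg', hm', hn', hdev⟩ := hnacc
  obtain ⟨j', hj'⟩ := hg'.1
  have hr0 : 0 ≤ rate D x b h₀ h' := Real.sqrt_nonneg _
  -- The violating bandwidth is not `Hn` itself, where the difference vanishes, and `Ĥ` is the next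
  -- grid point below `Hn`.
  have hh' : h' ≤ Hh := by
    have h1 : h' ≠ Hn := by
      rintro rfl
      rw [sub_self, abs_zero] at hdev
      nlinarith
    have h2 : jn < j' := hlt_of_pow_lt (by rw [← hj']; exact lt_of_le_of_ne hn' h1)
    rw [hj', hjh]
    exact hpow_le h2
  have hrr : rate D x b h₀ Hh ≤ rate D x b h₀ h' := hrate hg' hh'
  have hjs' : js ≤ j' := (hlt_of_pow_lt (by rw [← hj', ← hjs]; exact hh'.trans_lt hcase)).le
  have hb' := hb1 h' hg' hm' (hn'.trans hns)
  have hbn := hb1 Hn hgn (hmh.trans hhn.le) hns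
  have hων : 2 * ω ≤ ν / 4 * rate D x b h₀ h' := by
    have e1 : 8 * ω ≤ T * ν * ω := mul_le_mul_of_nonneg_right hTν hω0.le
    have e2 : ν * (T * ω) ≤ ν * rate D x b h₀ h' :=
      mul_le_mul_of_nonneg_left (hr.le.trans hrr) hν.le
    linarith
  -- The two biases use up at most `ν/4` of the `ν` violation; one of the two noises carries half of
  -- the remaining `3ν/4`.
  have hsplit : 3 * ν / 8 * rate D x b h₀ h' ≤ |fHat D x h' - fTilde D f x h'| ∨
      3 * ν / 8 * rate D x b h₀ h' ≤ |fHat D x Hn - fTilde D f x Hn| := by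
    by_contra! hcon
    have e1 := abs_sub_le (fHat D x Hn) (fTilde D f x Hn) (fHat D x h')
    have e2 := abs_sub_le (fTilde D f x Hn) (f x) (fHat D x h')
    have e3 := abs_sub_le (f x) (fTilde D f x h') (fHat D x h')
    rw [abs_sub_comm (f x) (fTilde D f x h'), abs_sub_comm (fTilde D f x h') (fHat D x h')] at e3
    linarith
  have hν8 : 0 ≤ 3 * ν / 8 := by positivity
  rcases hsplit with h1 | h1
  · refine ⟨j', htop j' hjs', ?_⟩
    have h6 := hsmall j' (by rw [← hj']; exact hg'.2) (by rw [← hj']; exact hh'.trans_lt hcase)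
    rw [LargeNoise]
    rw [← hj'] at h6 ⊢
    exact ⟨hg'.2, hrate_u hm', h1, (mul_le_mul_of_nonneg_left h6 hν8).trans h1⟩
  · refine ⟨jn, htop jn (by omega), hgn.2, hrate_u (hmh.trans hhn.le), ?_, ?_⟩
    · exact (mul_le_mul_of_nonneg_left (hrate hg' hn') hν8).trans h1
    · refine (mul_le_mul_of_nonneg_left ?_ hν8).trans h1
      exact (min_le_min_right u₀ (hanti jn (by omega))).trans (hfloor.trans (hrω.trans hrr))

end Selection
theorem aemeasurable_of_eventually_eq {Ω : Type*} {mΩ : MeasurableSpace Ω} {P : Measure Ω}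
    {F : ℕ → Ω → ℝ} {G : Ω → ℝ} (hF : ∀ n, Measurable (F n))
    (h : ∀ᵐ ω ∂P, ∀ᶠ n in Filter.atTop, F n ω = G ω) : AEMeasurable G P := by
  refine aemeasurable_of_tendsto_metrizable_ae Filter.atTop (fun n => (hF n).aemeasurable) ?_
  filter_upwards [h] with ω hω
  exact tendsto_const_nhds.congr' (hω.mono fun n hn => hn.symm)

theorem fHat_sub_fTilde {E : Type*} [PseudoMetricSpace E] {D : Obs E} {f : E → ℝ} {x : E}
    {e : ℕ → ℝ} (he : ∀ k, D.Y (k + 1) = f (D.X k) + e (k + 1)) (h : ℝ) :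
    fHat D x h - fTilde D f x h =
      (∑ k ∈ Finset.range D.N, weight D x h k * e (k + 1)) / L D x h := by
  rw [fHat, fTilde, ← mul_sub, ← Finset.sum_sub_distrib, one_div_mul_eq_div]
  congr 1
  refine Finset.sum_congr rfl fun k _ => ?_
  rw [he k]
  ring

/-! ### Noise at a fixed bandwidth -/

section Deviation

variable {Ω E : Type*} {mΩ : MeasurableSpace Ω} {P : Measure Ω} [IsProbabilityMeasure P]
  {ℱ : Filtration ℕ mΩ} [PseudoMetricSpace E] [MeasurableSpace E] [OpensMeasurableSpace E]
  {X : ℕ → Ω → E} {Y ε σ : ℕ → Ω → ℝ} {N : Ω → WithTop ℕ} {μ γ : ℝ}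

theorem sum_range_untopD {a : ℕ → ℝ} {N : WithTop ℕ} (hN : N ≠ ⊤)
    (ha : ∀ k : ℕ, ¬(k : WithTop ℕ) < N → a k = 0) :
    ∀ᶠ n in Filter.atTop, ∑ k ∈ Finset.range n, a k = ∑ k ∈ Finset.range (N.untopD 0), a k := by
  lift N to ℕ using hN
  filter_upwards [Filter.eventually_ge_atTop N] with n hn
  refine (Finset.sum_subset (Finset.range_mono hn) fun k _ hk => ha k ?_).symm
  simpa using hk

theorem SubgaussianNoise.measure_deviation_le (hε : SubgaussianNoise P ℱ ε σ μ γ) (hμ : 0 < μ)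
    (hγ : 0 < γ) (hX : ∀ k, Measurable[ℱ k] (X k)) (hN : IsStoppingTime ℱ N)
    (hNfin : ∀ᵐ ω ∂P, N ω ≠ ⊤) (x : E) (h : ℝ)
    {p y u w : ℝ} (hp : 0 < p) (hy : 0 < y) (hu : 0 < u) (hw : 0 < w) {n : ℕ}
    (hn : u ≤ 2 ^ n * w) :
    P {ω | p / u ^ 2 ≤ L (observe X Y σ N ω) x h ∧
      y * Real.sqrt (p * L (observe X Y σ N ω) x h) ≤
        |∑ k ∈ Finset.range (observe X Y σ N ω).N,
          weight (observe X Y σ N ω) x h k * ε (k + 1) ω| ∧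
      y * w * L (observe X Y σ N ω) x h ≤ |∑ k ∈ Finset.range (observe X Y σ N ω).N,
          weight (observe X Y σ N ω) x h k * ε (k + 1) ω|} ≤
      ENNReal.ofReal (2 * (n + 1) * Real.exp (-(3 / (16 * ((1 + γ) / μ)) * y ^ 2 * p))) := by
  -- Stopping is absorbed into the coefficients: `{k < N}` is the complement of `{N ≤ k}`, hence
  -- known at time `k`.
  set A : ℕ → Set Ω := fun k => {ω | (k : WithTop ℕ) < N ω} ∩ X k ⁻¹' Metric.closedBall x h
  have hA : ∀ k, MeasurableSet[ℱ k] (A k) := fun k => by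
    refine MeasurableSet.inter ?_ (hX k Metric.isClosed_closedBall.measurableSet)
    have : {ω | (k : WithTop ℕ) < N ω} = {ω | N ω ≤ k}ᶜ := by ext; simp
    rw [this]
    exact (hN k).compl
  set s : ℕ → Ω → ℝ := fun k => (A k).indicator fun ω => 1 / σ k ω with hs
  have hsm : ∀ k, Measurable[ℱ k] (s k) := fun k =>
    (measurable_const.div (hε.measurable_scale k)).indicator (hA k)
  have hs0 : ∀ᵐ ω ∂P, ∀ k, 0 ≤ s k ω := by
    filter_upwards [hε.scale_pos] with ω hω k
    exact Set.indicator_apply_nonneg fun _ => (one_div_pos.mpr (hω k)).le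
  have hsw : ∀ ω (k : ℕ), (k : WithTop ℕ) < N ω →
      s k ω ^ 2 = weight (observe X Y σ N ω) x h k ∧
      s k ω * (ε (k + 1) ω / σ k ω) = weight (observe X Y σ N ω) x h k * ε (k + 1) ω := by
    intro ω k hk
    by_cases hx : X k ω ∈ Metric.closedBall x h
    · have : ω ∈ A k := ⟨hk, hx⟩
      simp only [hs, weight, observe, Set.indicator_of_mem this, Set.indicator_of_mem hx]
      exact ⟨by ring, by ring⟩
    · have : ω ∉ A k := fun h' => hx h'.2
      simp [hs, weight, observe, Set.indicator_of_notMem this, Set.indicator_of_notMem hx]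
  have hsn : ∀ ω (k : ℕ), ¬(k : WithTop ℕ) < N ω → s k ω = 0 := fun ω k hk =>
    Set.indicator_of_notMem (fun h' => hk h'.1) _
  have hlt : ∀ ω (k : ℕ), N ω ≠ ⊤ → k ∈ Finset.range ((N ω).untopD 0) → (k : WithTop ℕ) < N ω := by
    intro ω k h1 h2
    obtain ⟨M, hM⟩ := WithTop.ne_top_iff_exists.mp h1
    rw [← hM] at h2 ⊢
    exact WithTop.coe_lt_coe.mpr (Finset.mem_range.mp h2)
  have hV : ∀ᵐ ω ∂P, ∀ᶠ n in Filter.atTop, ∑ k ∈ Finset.range n, s k ω ^ 2 =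
      L (observe X Y σ N ω) x h := by
    filter_upwards [hNfin] with ω hω
    filter_upwards [sum_range_untopD hω (a := fun k => s k ω ^ 2)
      fun k hk => by simp [hsn ω k hk]] with n hn
    rw [hn]
    exact Finset.sum_congr rfl fun k hk => (hsw ω k (hlt ω k hω hk)).1
  have hS : ∀ᵐ ω ∂P, ∀ᶠ n in Filter.atTop,
      ∑ k ∈ Finset.range n, s k ω * (ε (k + 1) ω / σ k ω) =
        ∑ k ∈ Finset.range (observe X Y σ N ω).N,
          weight (observe X Y σ N ω) x h k * ε (k + 1) ω := by
    filter_upwards [hNfin] with ω hω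
    filter_upwards [sum_range_untopD hω (a := fun k => s k ω * (ε (k + 1) ω / σ k ω))
      fun k hk => by simp [hsn ω k hk]] with n hn
    rw [hn]
    exact Finset.sum_congr rfl fun k hk => (hsw ω k (hlt ω k hω hk)).2
  have hεm := fun k => (hε.increment.measurable k).mono (ℱ.le (k + 1)) le_rfl
  have hσm := fun k => (hε.measurable_scale k).mono (ℱ.le k) le_rfl
  have hsm' := fun k => (hsm k).mono (ℱ.le k) le_rfl
  exact LepskiRegression.measure_deviation_le (by positivity)
    (aemeasurable_of_eventually_eq (fun n => by fun_prop) hS)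
    (aemeasurable_of_eventually_eq (fun n => by fun_prop) hV)
    (hε.lintegral_exp_le hμ hγ hsm hs0 hS hV) hp hy hu hw hn

/-- Here `p = ψ(h₀ q ^ j)`: the condition `rate ≤ u₀` reads `p / u₀ ^ 2 ≤ L`, and `rate * L = √(p
L)`. -/
theorem SubgaussianNoise.measure_largeNoise_le (hε : SubgaussianNoise P ℱ ε σ μ γ) (hμ : 0 < μ)
    (hγ : 0 < γ) (hX : ∀ k, Measurable[ℱ k] (X k)) (hN : IsStoppingTime ℱ N)
    (hNfin : ∀ᵐ ω ∂P, N ω ≠ ⊤) {f : E → ℝ}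
    (hY : ∀ᵐ ω ∂P, ∀ k, Y (k + 1) ω = f (X k ω) + ε (k + 1) ω) (x : E)
    {h₀ q b u₀ δ₀ α₀ y : ℝ} (hh₀ : 0 < h₀) (hq₀ : 0 < q) (hq₁ : q < 1) (hb : 0 < b)
    (hu₀ : 0 < u₀) (hδ₀ : 0 < δ₀) (hy : 0 < y) {j n : ℕ}
    (hn : u₀ ≤ 2 ^ n * min (δ₀ * (q ^ j) ^ α₀) u₀) :
    P {ω | LargeNoise (observe X Y σ N ω) f x h₀ q b u₀ δ₀ α₀ j y} ≤
      ENNReal.ofReal (2 * (n + 1) *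
        Real.exp (-(3 / (16 * ((1 + γ) / μ)) * y ^ 2 * (1 + b * (j * Real.log (1 / q)))))) := by
  have hψ : psi b h₀ (h₀ * q ^ j) = 1 + b * (j * Real.log (1 / q)) := by
    rw [psi, log_div_mul_pow hh₀]
  have hψ1 := one_le_psi hb hh₀ hq₀ hq₁ j
  rw [hψ] at hψ1
  refine le_trans (measure_mono_ae ?_) (hε.measure_deviation_le (Y := Y) hμ hγ hX hN hNfin x
    (h₀ * q ^ j) (zero_lt_one.trans_le hψ1) hy hu₀ (lt_min (by positivity) hu₀) hn)
  filter_upwards [hY] with ω hω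
  rintro ⟨hL, h1, h2, h3⟩
  have hM := fHat_sub_fTilde (D := observe X Y σ N ω) (f := f) (x := x) (e := fun k => ε k ω)
    hω (h₀ * q ^ j)
  rw [hM, abs_div, abs_of_pos hL, le_div_iff₀ hL] at h2 h3
  rw [rate, hψ] at h1 h2
  refine ⟨?_, ?_, h3⟩
  · rw [Real.sqrt_le_left hu₀.le, div_le_iff₀ hL] at h1
    rw [div_le_iff₀ (by positivity)]
    linarith
  · refine le_trans (le_of_eq ?_) h2
    have hp0 : 0 ≤ 1 + b * (j * Real.log (1 / q)) := zero_le_one.trans hψ1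
    generalize L (observe X Y σ N ω) x (h₀ * q ^ j) = l at *
    have : (1 + b * (j * Real.log (1 / q))) * l = (1 + b * (j * Real.log (1 / q))) / l * l ^ 2 := by
      field_simp
    rw [this, Real.sqrt_mul' _ (sq_nonneg l), Real.sqrt_sq hL.le, mul_assoc]

end Deviation

/-! ### Summation over the grid -/

theorem exists_peeling_number {q u₀ δ₀ α₀ : ℝ} (hq₀ : 0 < q) (hu₀ : 0 < u₀) (hδ₀ : 0 < δ₀) :
    ∃ m₀ m₁ : ℕ, ∀ j : ℕ, u₀ ≤ 2 ^ (m₀ + m₁ * j) * min (δ₀ * (q ^ j) ^ α₀) u₀ := by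
  obtain ⟨m₀, h0⟩ := pow_unbounded_of_one_lt (u₀ / δ₀) one_lt_two
  obtain ⟨m₁, h1⟩ := pow_unbounded_of_one_lt (1 / q ^ α₀) one_lt_two
  refine ⟨m₀, m₁, fun j => ?_⟩
  have hqa : 0 < q ^ α₀ := by positivity
  rw [div_lt_iff₀ hδ₀] at h0
  rw [div_lt_iff₀ hqa] at h1
  have h2 : (1 : ℝ) ≤ (2 ^ m₁ * q ^ α₀) ^ j := one_le_pow₀ h1.le
  rcases min_choice (δ₀ * (q ^ j) ^ α₀) u₀ with h | h <;> rw [h]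
  · rw [← Real.rpow_pow_comm hq₀.le]
    calc u₀ ≤ 2 ^ m₀ * δ₀ := h0.le
      _ ≤ 2 ^ m₀ * δ₀ * (2 ^ m₁ * q ^ α₀) ^ j := le_mul_of_one_le_right (by positivity) h2
      _ = _ := by rw [mul_pow, pow_add, pow_mul]; ring
  · exact le_mul_of_one_le_left hu₀.le (one_le_pow₀ one_le_two)

/-- The series `∑ j, (j + 1) exp (-r j)`. -/
noncomputable def expSeries (r : ℝ) : ℝ := ∑' j : ℕ, ((j : ℝ) + 1) * Real.exp (-(r * j))

theorem expSeries_nonneg (r : ℝ) : 0 ≤ expSeries r := tsum_nonneg fun j => by positivity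

theorem summable_succ_mul_exp {r : ℝ} (hr : 0 < r) :
    Summable fun j : ℕ => ((j : ℝ) + 1) * Real.exp (-(r * j)) := by
  have h1 : ‖Real.exp (-r)‖ < 1 := by
    rw [Real.norm_eq_abs, abs_of_pos (Real.exp_pos _), Real.exp_lt_one_iff]
    linarith
  have h2 := (summable_pow_mul_geometric_of_norm_lt_one 1 h1).add
    (summable_geometric_of_norm_lt_one h1)
  refine h2.congr fun j => ?_
  rw [← Real.exp_nat_mul, pow_one, show -(r * j) = (j : ℝ) * -r by ring]
  ring

/-- Decay of `e j` is asked for only when `B j` is nonempty, because a deterministic constraint on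
`j` may be part of the event. -/
theorem measure_iUnion_le_expSeries {Ω : Type*} {mΩ : MeasurableSpace Ω} {P : Measure Ω}
    {B : ℕ → Set Ω} {A M r : ℝ} (hA : 0 ≤ A) (hM : 0 ≤ M) (hr : 0 < r) {e : ℕ → ℝ}
    (hB : ∀ j, P (B j) ≤ ENNReal.ofReal (A * (j + 1) * e j))
    (he : ∀ j, (B j).Nonempty → e j ≤ M * Real.exp (-(r * j))) :
    P (⋃ j, B j) ≤ ENNReal.ofReal (A * M * expSeries r) := by
  have hle : ∀ j, P (B j) ≤ ENNReal.ofReal (A * M * ((j + 1) * Real.exp (-(r * j)))) := by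
    intro j
    rcases (B j).eq_empty_or_nonempty with h | h
    · simp [h]
    · refine (hB j).trans (ENNReal.ofReal_le_ofReal ?_)
      refine (mul_le_mul_of_nonneg_left (he j h) (by positivity)).trans_eq ?_
      ring
  refine (measure_iUnion_le B).trans ((ENNReal.tsum_le_tsum hle).trans_eq ?_)
  rw [expSeries, ← tsum_mul_left, ENNReal.ofReal_tsum_of_nonneg (fun j => by positivity)
    ((summable_succ_mul_exp hr).mul_left _)]

theorem exp_neg_rate_le_of_one_le {c y b l M : ℝ} (hc : 0 ≤ c) (hb : 0 ≤ b) (hl : 0 ≤ l)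
    (hy : 1 ≤ y) (hM : Real.exp (-(c * y ^ 2)) ≤ M) (j : ℕ) :
    Real.exp (-(c * y ^ 2 * (1 + b * (j * l)))) ≤ M * Real.exp (-(c * b * l * j)) := by
  refine le_trans ?_ (mul_le_mul_of_nonneg_right hM (Real.exp_pos _).le)
  rw [← Real.exp_add]
  refine Real.exp_le_exp.mpr ?_
  have h2 : 1 ≤ y ^ 2 := one_le_pow₀ hy
  have h3 : 0 ≤ c * b * l * j := by positivity
  have h4 := mul_le_mul_of_nonneg_right h2 h3
  linarith

/-- The decay rate `C b` in `j` is split: the share `ρ α₀` is traded through `hj` for `T ^ (-ρ)`,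
and the rest keeps the series convergent. -/
theorem exp_neg_rate_le_of_small {C b q α₀ δ₀ u₀ T ρ : ℝ} (hC : 0 ≤ C) (hq₀ : 0 < q)
    (hδ₀ : 0 < δ₀) (hT : 0 < T) (hu₀ : 0 < u₀) (hρ : 0 ≤ ρ) {j : ℕ}
    (hj : T * (δ₀ * (q ^ j) ^ α₀) ≤ u₀) :
    Real.exp (-(C * (1 + b * (j * Real.log (1 / q))))) ≤
      (u₀ / δ₀) ^ ρ * T ^ (-ρ) * Real.exp (-((C * b - ρ * α₀) * Real.log (1 / q) * j)) := by
  have hsmall : Real.exp (-(ρ * α₀ * Real.log (1 / q) * j)) ≤ (u₀ / δ₀) ^ ρ * T ^ (-ρ) := by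
    have e1 : Real.exp (-(ρ * α₀ * Real.log (1 / q) * j)) = ((q ^ j) ^ α₀) ^ ρ := by
      rw [← Real.rpow_mul (by positivity), Real.rpow_def_of_pos (by positivity), Real.log_pow,
        one_div, Real.log_inv]
      congr 1
      ring
    have e2 : ((q ^ j) ^ α₀ : ℝ) ≤ u₀ / δ₀ / T := by
      rw [div_div, le_div_iff₀ (by positivity)]
      linarith
    rw [e1]
    refine (Real.rpow_le_rpow (by positivity) e2 hρ).trans_eq ?_
    rw [Real.div_rpow (by positivity) hT.le, div_eq_mul_inv, ← Real.rpow_neg hT.le]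
  refine le_trans ?_ (mul_le_mul_of_nonneg_right hsmall (Real.exp_pos _).le)
  rw [← Real.exp_add]
  refine Real.exp_le_exp.mpr ?_
  linarith

/-- The probability of a large error of the selected estimator, with a threshold `T` for the ratio
of the rates and a level `y` for the normalized noise. -/
theorem SubgaussianNoise.measure_error_le {Ω E : Type*} {mΩ : MeasurableSpace Ω} {P : Measure Ω}
    [IsProbabilityMeasure P] {ℱ : Filtration ℕ mΩ} [PseudoMetricSpace E] [MeasurableSpace E]
    [OpensMeasurableSpace E] {X : ℕ → Ω → E} {Y ε σ : ℕ → Ω → ℝ} {N : Ω → WithTop ℕ} {μ γ : ℝ}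
    (hε : SubgaussianNoise P ℱ ε σ μ γ) (hμ : 0 < μ)
    (hγ : 0 < γ) (hX : ∀ k, Measurable[ℱ k] (X k)) (hN : IsStoppingTime ℱ N)
    (hNfin : ∀ᵐ ω ∂P, N ω ≠ ⊤) {f : E → ℝ}
    (hY : ∀ᵐ ω ∂P, ∀ k, Y (k + 1) ω = f (X k ω) + ε (k + 1) ω) (x : E)
    {h₀ q b u₀ δ₀ α₀ ν t T y c ρ M : ℝ} {m₀ m₁ : ℕ} {W : ℝ → Ω → ℝ}
    (hh₀ : 0 < h₀) (hq₀ : 0 < q) (hq₁ : q < 1) (hb : 0 < b)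
    (hu₀ : 0 < u₀) (hδ₀ : 0 < δ₀) (hα₀ : 0 < α₀) (hν : 0 < ν) (hρ : 0 ≤ ρ)
    (hc : c = 3 / (16 * ((1 + γ) / μ))) (hρc : ρ * α₀ < c * (3 * ν / 8) ^ 2 * b)
    (hm : ∀ j : ℕ, u₀ ≤ 2 ^ (m₀ + m₁ * j) * min (δ₀ * (q ^ j) ^ α₀) u₀)
    (hy : 1 ≤ y) (hT : 1 ≤ T) (hTν : 8 ≤ T * ν) (hyt : y + ν + 1 ≤ t) (hyT : y * T + 1 ≤ t)
    (hyM : Real.exp (-(c * y ^ 2)) ≤ M)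
    (hbias : ∀ᵐ ω ∂P, BoundsBias (observe X Y σ N ω) f x (fun h => W h ω) h₀ q b u₀) :
    P ({ω | t * Wbar (fun h => W h ω) h₀ u₀ δ₀ α₀
          (Hstar (observe X Y σ N ω) x (fun h => W h ω) h₀ q b u₀ δ₀ α₀) ≤
            |fHat (observe X Y σ N ω) x (Hhat (observe X Y σ N ω) x h₀ q b ν u₀) - f x|} ∩
        {ω | GoodEvent (observe X Y σ N ω) x (fun h => W h ω) h₀ q b u₀ δ₀ α₀}) ≤
      ENNReal.ofReal (2 * (m₀ + m₁ + 1) * M * expSeries (c * b * Real.log (1 / q)) +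
        2 * (m₀ + m₁ + 1) * ((u₀ / δ₀) ^ ρ * T ^ (-ρ)) *
          expSeries ((c * (3 * ν / 8) ^ 2 * b - ρ * α₀) * Real.log (1 / q))) := by
  have hc0 : 0 < c := by rw [hc]; positivity
  have hl0 : 0 < Real.log (1 / q) := Real.log_pos (by rw [lt_div_iff₀ hq₀]; linarith)
  have hM0 : 0 ≤ M := (Real.exp_pos _).le.trans hyM
  have hAj : ∀ j : ℕ, 2 * (((m₀ + m₁ * j : ℕ) : ℝ) + 1) ≤ 2 * (m₀ + m₁ + 1) * (j + 1) :=
    fun j => by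
      push_cast
      nlinarith [mul_nonneg (Nat.cast_nonneg' (α := ℝ) m₀) (Nat.cast_nonneg' (α := ℝ) j),
        Nat.cast_nonneg' (α := ℝ) m₁, Nat.cast_nonneg' (α := ℝ) j]
  have hdev : ∀ {z : ℝ}, 0 < z → ∀ j : ℕ,
      P {ω | LargeNoise (observe X Y σ N ω) f x h₀ q b u₀ δ₀ α₀ j z} ≤
        ENNReal.ofReal (2 * (m₀ + m₁ + 1) * (j + 1) *
          Real.exp (-(c * z ^ 2 * (1 + b * (j * Real.log (1 / q)))))) := by
    intro z hz j
    rw [hc]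
    exact (hε.measure_largeNoise_le hμ hγ hX hN hNfin hY x hh₀ hq₀ hq₁ hb hu₀ hδ₀ hz
      (hm j)).trans (ENNReal.ofReal_le_ofReal
        (mul_le_mul_of_nonneg_right (hAj j) (Real.exp_pos _).le))
  have hfirst := measure_iUnion_le_expSeries (by positivity) hM0
    (mul_pos (mul_pos hc0 hb) hl0) (hdev (zero_lt_one.trans_le hy))
    fun j _ => exp_neg_rate_le_of_one_le hc0.le hb.le hl0.le hy hyM j
  have hsecond := measure_iUnion_le_expSeries (P := P) (A := 2 * (m₀ + m₁ + 1))
    (M := (u₀ / δ₀) ^ ρ * T ^ (-ρ)) (by positivity) (by positivity)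
    (mul_pos (sub_pos.mpr hρc) hl0)
    (B := fun j => {ω | T * (δ₀ * (q ^ j) ^ α₀) ≤ u₀ ∧
      LargeNoise (observe X Y σ N ω) f x h₀ q b u₀ δ₀ α₀ j (3 * ν / 8)})
    (fun j => (measure_mono fun ω hω => hω.2).trans (hdev (z := 3 * ν / 8) (by positivity) j))
    fun j hj => exp_neg_rate_le_of_small (by positivity) hq₀ hδ₀ (by linarith) hu₀ hρ
      hj.some_mem.1
  have hS₁ := expSeries_nonneg (c * b * Real.log (1 / q))
  have hS₂ := expSeries_nonneg ((c * (3 * ν / 8) ^ 2 * b - ρ * α₀) * Real.log (1 / q))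
  rw [ENNReal.ofReal_add (by positivity) (by positivity)]
  refine le_trans (measure_mono_ae ?_) ((measure_union_le _ _).trans (add_le_add hfirst hsecond))
  filter_upwards [hbias] with ω hω
  rintro ⟨herr, hgood⟩
  rcases exists_largeNoise hh₀ hq₀ hq₁ hb hu₀ hδ₀ hα₀ hν (zero_lt_one.trans_le hy) hT hTν hyt hyT
    hω hgood herr with ⟨j, hj⟩ | ⟨j, hj⟩
  · exact Or.inl (Set.mem_iUnion.mpr ⟨j, hj⟩)
  · exact Or.inr (Set.mem_iUnion.mpr ⟨j, hj⟩)

/-- The requirements on `t = r ^ 3` under which the deviation bound is proved, with the threshold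
`r ^ 2` for the ratio of the rates and the level `r / 2` for the normalized noise. -/
theorem eventually_scale_conditions {c ν : ℝ} (hc : 0 < c) (hν : 0 < ν) (ρ : ℝ) :
    ∀ᶠ r : ℝ in Filter.atTop, 2 ≤ r ∧ 8 ≤ r ^ 2 * ν ∧ r / 2 + ν + 1 ≤ r ^ 3 ∧
      r / 2 * r ^ 2 + 1 ≤ r ^ 3 ∧ Real.exp (-(c * (r / 2) ^ 2)) ≤ (r ^ 3) ^ (-ρ) := by
  have h := (isLittleO_exp_neg_mul_rpow_atTop (a := c / 4) (by positivity) (-(3 * ρ))).bound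
    zero_lt_one
  filter_upwards [h, Filter.eventually_ge_atTop 2, Filter.eventually_ge_atTop (8 / ν),
    Filter.eventually_ge_atTop ν] with r h1 h2 h3 h4
  have hr : 0 < r := by linarith
  rw [div_le_iff₀ hν] at h3
  refine ⟨h2, ?_, ?_, ?_, ?_⟩
  · nlinarith [mul_pos hr hν]
  · nlinarith [mul_pos hr hr]
  · nlinarith [mul_pos hr hr]
  · rw [one_mul, Real.norm_eq_abs, Real.norm_eq_abs, abs_of_pos (Real.exp_pos _),
      abs_of_pos (Real.rpow_pos_of_pos hr _)] at h1
    rw [← Real.rpow_natCast r 3, ← Real.rpow_mul hr.le,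
      show ((3 : ℕ) : ℝ) * -ρ = -(3 * ρ) by push_cast; ring]
    refine le_trans (Real.exp_le_exp.mpr ?_) h1
    nlinarith [mul_pos hc hr]

end LepskiRegression

/-! ### Choice of the thresholds and conclusion -/

theorem theorem1
    (μ γ q b u₀ δ₀ α₀ ν ρ : ℝ) (hμ : 0 < μ) (hγ : 0 < γ) (hq₀ : 0 < q) (hq₁ : q < 1) (hb : 0 < b)
    (hu₀ : 0 < u₀) (hδ₀ : 0 < δ₀) (hα₀ : 0 < α₀) (hν : 0 < ν)
    (hρ₀ : 0 < ρ) (hρ₁ : ρ < b * μ * ν ^ 2 / (64 * α₀ * (1 + γ))) :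
    ∃ C₀ t₀ : ℝ, 0 < C₀ ∧ 0 < t₀ ∧
      ∀ (Ω : Type u) [mΩ : MeasurableSpace Ω] (P : Measure Ω) [IsProbabilityMeasure P]
        (ℱ : Filtration ℕ mΩ) (d : ℕ)
        (X : ℕ → Ω → EuclideanSpace ℝ (Fin d)) (Y ε σ : ℕ → Ω → ℝ)
        (f : EuclideanSpace ℝ (Fin d) → ℝ) (x : EuclideanSpace ℝ (Fin d))
        (N : Ω → WithTop ℕ) (h₀ : ℝ) (W : ℝ → Ω → ℝ),
        -- the regression model
        (∀ k, Measurable[ℱ k] (X k)) →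
        (∀ k, Measurable[ℱ (k + 1)] (Y (k + 1))) →
        (∀ᵐ ω ∂P, ∀ k, Y (k + 1) ω = f (X k ω) + ε (k + 1) ω) →
        LepskiRegression.IsMartingaleIncrement P ℱ ε →
        -- the noise is conditionally subgaussian after normalization
        (∀ k, Measurable[ℱ k] (σ k)) →
        (∀ᵐ ω ∂P, ∀ k, 0 < σ k ω) →
        (∀ k, ∀ᵐ ω ∂P,
          condLExp (ℱ k) P
            (fun ω' => ENNReal.ofReal (Real.exp (μ * (ε (k + 1) ω' ^ 2 / σ k ω' ^ 2)))) ω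
              ≤ ENNReal.ofReal γ) →
        -- the sample size is a finite stopping time
        IsStoppingTime ℱ N →
        (∀ᵐ ω ∂P, N ω ≠ ⊤ ∧ 1 ≤ N ω) →
        -- the family of bounds on the bias
        0 < h₀ →
        (∀ j : ℕ, Measurable (W (h₀ * q ^ j))) →
        (∀ᵐ ω ∂P, ∀ h ∈ LepskiRegression.grid (LepskiRegression.observe X Y σ N ω) x h₀ q, 0 ≤ W h ω) →
        (∀ᵐ ω ∂P, LepskiRegression.BoundsBias (LepskiRegression.observe X Y σ N ω) f x (fun h => W h ω) h₀ q b u₀) →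
        ∀ t : ℝ, t₀ ≤ t →
          P.real
            ({ω | t * LepskiRegression.Wbar (fun h => W h ω) h₀ u₀ δ₀ α₀
                    (LepskiRegression.Hstar (LepskiRegression.observe X Y σ N ω) x (fun h => W h ω) h₀ q b u₀ δ₀ α₀)
                  ≤ |LepskiRegression.fHat (LepskiRegression.observe X Y σ N ω) x
                      (LepskiRegression.Hhat (LepskiRegression.observe X Y σ N ω) x h₀ q b ν u₀) - f x|} ∩
              {ω | LepskiRegression.GoodEvent (LepskiRegression.observe X Y σ N ω) x (fun h => W h ω) h₀ q b u₀ δ₀ α₀})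
            ≤ C₀ * (Real.log (t + 1)) ^ (1 + ρ / 2) / t ^ ρ := by
  obtain ⟨c, hc⟩ : ∃ c : ℝ, c = 3 / (16 * ((1 + γ) / μ)) := ⟨_, rfl⟩
  have hc0 : 0 < c := by rw [hc]; positivity
  -- The exponent `3ρ/2` compensates for `T = t ^ (2/3)`. There is room: `(3/2) / 64 = 24/1024 <
  -- 27/1024`.
  have hρc : 3 * ρ / 2 * α₀ < c * (3 * ν / 8) ^ 2 * b := by
    rw [lt_div_iff₀ (by positivity)] at hρ₁
    have h1 : c * (3 * ν / 8) ^ 2 * b * (1 + γ) = 27 / 1024 * (b * μ * ν ^ 2) := by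
      rw [hc]; field_simp; ring
    have h2 : 0 < b * μ * ν ^ 2 := by positivity
    have h3 : 3 * ρ / 2 * α₀ * (1 + γ) < c * (3 * ν / 8) ^ 2 * b * (1 + γ) := by
      rw [h1]; linarith
    exact lt_of_mul_lt_mul_right h3 (by positivity)
  obtain ⟨m₀, m₁, hm⟩ := LepskiRegression.exists_peeling_number (α₀ := α₀) hq₀ hu₀ hδ₀
  obtain ⟨t₁, ht₁⟩ := Filter.eventually_atTop.mp
    ((tendsto_rpow_atTop (y := 1 / 3) (by norm_num)).eventually
      (LepskiRegression.eventually_scale_conditions hc0 hν ρ))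
  obtain ⟨S₁, hS₁⟩ : ∃ S, S = LepskiRegression.expSeries (c * b * Real.log (1 / q)) := ⟨_, rfl⟩
  obtain ⟨S₂, hS₂⟩ : ∃ S, S = LepskiRegression.expSeries
    ((c * (3 * ν / 8) ^ 2 * b - 3 * ρ / 2 * α₀) * Real.log (1 / q)) := ⟨_, rfl⟩
  have hS₁0 : 0 ≤ S₁ := hS₁ ▸ LepskiRegression.expSeries_nonneg _
  have hS₂0 : 0 ≤ S₂ := hS₂ ▸ LepskiRegression.expSeries_nonneg _
  obtain ⟨C, hC⟩ : ∃ C : ℝ, C = 2 * (m₀ + m₁ + 1) * S₁ +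
    2 * (m₀ + m₁ + 1) * (u₀ / δ₀) ^ (3 * ρ / 2) * S₂ := ⟨_, rfl⟩
  have hC0 : 0 ≤ C := by rw [hC]; positivity
  refine ⟨C + 1, max t₁ 2, by linarith, by positivity, ?_⟩
  intro Ω mΩ P hP ℱ d X Y ε σ f x N h₀ W hX _ hY hε hσ hσ0 hexp hN hNfin hh₀ _ _ hbias t ht
  have ht2 : 2 ≤ t := (le_max_right _ _).trans ht
  have ht0 : 0 < t := by linarith
  obtain ⟨hr2, hrν, hrt, hrt', hrexp⟩ := ht₁ t ((le_max_left _ _).trans ht)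
  have hr3 : (t ^ (1 / 3 : ℝ)) ^ 3 = t := by
    rw [← Real.rpow_natCast, ← Real.rpow_mul ht0.le]; norm_num
  have hr2ρ : ((t ^ (1 / 3 : ℝ)) ^ 2) ^ (-(3 * ρ / 2)) = t ^ (-ρ) := by
    rw [← Real.rpow_natCast, ← Real.rpow_mul ht0.le, ← Real.rpow_mul ht0.le]
    congr 1
    push_cast
    ring
  rw [hr3] at hrt hrt' hrexp
  have hbound := LepskiRegression.SubgaussianNoise.measure_error_le (W := W)
    ⟨hε, hσ, hσ0, hexp⟩ hμ hγ hX hN (hNfin.mono fun ω hω => hω.1) hY x hh₀ hq₀ hq₁ hb hu₀ hδ₀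
    hα₀ hν (by positivity) hc hρc hm (by linarith) (one_le_pow₀ (by linarith)) hrν hrt hrt' hrexp
    hbias
  rw [hr2ρ, ← hS₁, ← hS₂] at hbound
  refine (ENNReal.toReal_le_of_le_ofReal (by positivity) hbound).trans ?_
  -- The probability is already at most `C * t ^ (-ρ)`; for `t ≥ 2` the logarithmic factor is at
  -- least one.
  have hlog : 1 ≤ Real.log (t + 1) := by
    rw [Real.le_log_iff_exp_le (by linarith)]
    linarith [Real.exp_one_lt_d9]
  have hlog' : 1 ≤ Real.log (t + 1) ^ (1 + ρ / 2) := Real.one_le_rpow hlog (by positivity)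
  rw [Real.rpow_neg ht0.le, le_div_iff₀ (by positivity)]
  calc _ = C := by rw [hC]; field_simp
    _ ≤ (C + 1) * Real.log (t + 1) ^ (1 + ρ / 2) := by nlinarith
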